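/- Let $(E,\mathcal E,\mu)$ be a $\sigma$-finite measure space with $\mu(E)=\infty$, and let $T:E\to E$ be a conservative, ergodic, measure preserving map. For $g\in L^1(\mu)$ let $\widehat T g$ be the Radon–Nikodym derivative with respect to $\mu$ of the image under $T$ of the signed measure $B\mapsto\int_B g\,d\mu$. Suppose that $T$ is pointwise dual ergodic with normalizing sequence $(a_n)_{n\ge1}$: $a_n\nearrow\infty$ and $$\frac1{a_n}\sum_{k=1}^n\widehat T^k g\to\int_E g\,d\mu\quad\mu\text{-a.e., for every } g\in L^1(\mu).$$ Suppose that $(a_n)$ is regularly varying with exponent $1-\beta$ for some $0<\beta\le1$, i.e. $a_{\lfloor cn\rfloor}/a_n\to c^{1-\beta}$ as $n\to\infty$ for every $c>0$. Let $A\in\mathcal E$, $0<\mu(A)<\infty$, be a uniform set for $T$: there exist a sequence $a'_n\nearrow\infty$ and a nonnegative measurable $g\in L^1(\mu)$, different from zero on a set of positive measure, such that $\frac1{a'_n}\sum_{k=1}^n\widehat T^k g\to\int_E g\,d\mu$ uniformly on $A$ outside of a $\mu$-null set. Let $\varphi_A(x)=\min\{n\ge1:T^nx\in A\}$ ($=\infty$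 if there is no such $n$) and, for $n\ge1$, let $$\mu_n(\cdot)=\frac{\mu(\cdot\cap\{\varphi_A\le n\})}{\mu(\varphi_A\le n)}.$$ Let $f:E\to\mathbb R$ be a bounded measurable function vanishing outside $A$, let $\|f\|_\infty=\inf\{M:|f|\le M\ \mu\text{-a.e. on }A\}$, and let $M_n(f)(x)=\max_{1\le k\le n}|f(T^kx)|$, with $M_0(f)=0$. Let $V_\beta$ be a random variable on a probability space $(\Omega',\mathcal F',P')$ with $P'(V_\beta\le x)=x^\beta$ for $0<x\le1$. Let $D[0,1]$ be the space of right-continuous functions $[0,1]\to\mathbb R$ with left limits, equipped with Skorohod's $M_1$ topology and its Borel $\sigma$-algebra. This is the topology of the metric $d(x,y)=\inf\max(\|u_1-u_2\|_\infty,\|r_1-r_2\|_\infty)$, the infimum being over all parametric representations $(u_1,r_1)$ of $x$ and $(u_2,r_2)$ of $y$. A parametric representation of $x$ is a continuous map $(u,r)$ of $[0,1]$ onto the completed graph $\{(z,t): z \text{ lies between } x(t-) \text{ and } x(t)\}$ (with $x(0-)=x(0)$) that is nondecreasing for the order of the graph: from left to right, and from $x(t-)$ to $x(t)$ along each vertical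 segment. Then every $\mu_n$, $n\ge1$, is a probability measure, the maps $x\mapsto(M_{\lfloor nt\rfloor}(f)(x),\,0\le t\le1)$ and $\omega\mapsto(\|f\|_\infty\mathbf 1_{\{V_\beta(\omega)\le t\}},\,0\le t\le1)$ are $D[0,1]$-valued random elements under $\mu_n$ and $P'$ respectively (measurable up to null sets), and, as $n\to\infty$, $$\left(M_{\lfloor nt\rfloor}(f),\ 0\le t\le1\right)\Rightarrow\|f\|_\infty\left(\mathbf 1_{\{V_\beta\le t\}},\ 0\le t\le1\right)\quad\text{in the } M_1 \text{ topology on } D[0,1],$$ where the law of the left-hand side is computed under $\mu_n$. -/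

import Mathlib

open MeasureTheory Filter Topology Set
open scoped ENNReal NNReal unitInterval

namespace MaxErgodic

/-! ### Regular variation, and the ergodic-theoretic notions -/

/-- A sequence of eventually positive reals is regularly varying (at infinity) with exponent `ρ`
if `a ⌊c n⌋ / a n → c ^ ρ` for every `c > 0`. -/
def IsRegularlyVarying (a : ℕ → ℝ) (ρ : ℝ) : Prop :=
  (∀ᶠ n in atTop, 0 < a n) ∧
    ∀ c : ℝ, 0 < c → Tendsto (fun n : ℕ => a ⌊c * n⌋₊ / a n) atTop (𝓝 (c ^ ρ))

section Ergodic

variable {E : Type*} [MeasurableSpace E]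

/-- The dual (transfer) operator: `dualOp T μ f` is the Radon-Nikodym derivative with respect to
`μ` of the image under `T` of the signed measure `B ↦ ∫ x in B, f x ∂μ`. It is used for
`μ`-integrable `f` only; the resulting function is again `μ`-integrable. -/
noncomputable def dualOp (T : E → E) (μ : Measure E) (f : E → ℝ) : E → ℝ :=
  SignedMeasure.rnDeriv (VectorMeasure.map (μ.withDensityᵥ f) T) μ

/-- The normalized sums `(1 / a n) * ∑_{k=1}^n T̂ᵏ f`. -/
noncomputable def dualAverage (T : E → E) (μ : Measure E) (a : ℕ → ℝ) (f : E → ℝ) (n : ℕ) (x : E) :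
    ℝ :=
  (1 / a n) * ∑ k ∈ Finset.Icc 1 n, ((dualOp T μ)^[k] f) x

/-- `a n ↗ ∞` along `n = 1, 2, …`. -/
def IncreasesToInfinity (a : ℕ → ℝ) : Prop :=
  MonotoneOn a (Ici 1) ∧ Tendsto a atTop atTop

/-- `T` is a conservative, ergodic, measure preserving map, pointwise dual ergodic with
normalizing sequence `a`. (`Ergodic` includes measure preservation.) -/
structure IsPointwiseDualErgodic (T : E → E) (μ : Measure E) (a : ℕ → ℝ) : Prop where
  conservative : Conservative T μ
  ergodic : Ergodic T μ
  increases : IncreasesToInfinity a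
  tendsto_ae : ∀ f : E → ℝ, Integrable f μ →
    ∀ᵐ x ∂μ, Tendsto (fun n => dualAverage T μ a f n x) atTop (𝓝 (∫ y, f y ∂μ))

/-- `A` is a uniform set for `T`: it has positive finite measure, and for some normalizing sequence
and some nontrivial nonnegative integrable function `g`, the normalized sums of `T̂ᵏ g` converge
to `∫ g dμ` uniformly on `A` outside of a null set. -/
structure IsUniformSet (T : E → E) (μ : Measure E) (A : Set E) : Prop where
  measurableSet : MeasurableSet A
  measure_pos : 0 < μ A
  measure_lt_top : μ A < ∞
  exists_uniform : ∃ (a : ℕ → ℝ) (g : E → ℝ), IncreasesToInfinity a ∧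
    Measurable g ∧ (∀ x, 0 ≤ g x) ∧ Integrable g μ ∧ 0 < μ {x | g x ≠ 0} ∧
    ∃ N : Set E, μ N = 0 ∧
      TendstoUniformlyOn (dualAverage T μ a g) (fun _ => ∫ y, g y ∂μ) atTop (A \ N)

/-- The first entrance time `φ_A(x) = min {n ≥ 1 : Tⁿ x ∈ A}` (`⊤` if there is no such `n`). -/
noncomputable def firstEntrance (T : E → E) (A : Set E) (x : E) : ℕ∞ :=
  sInf ((fun n : ℕ => (n : ℕ∞)) '' {n : ℕ | 1 ≤ n ∧ T^[n] x ∈ A})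

/-- `μ_n = μ(· ∩ {φ_A ≤ n}) / μ(φ_A ≤ n)`. -/
noncomputable def entranceMeasure (T : E → E) (μ : Measure E) (A : Set E) (n : ℕ) : Measure E :=
  ProbabilityTheory.cond μ {x | firstEntrance T A x ≤ (n : ℕ∞)}

/-- `‖f‖_∞ = inf {M : |f| ≤ M a.e. on A}`. -/
noncomputable def supNormOn (μ : Measure E) (A : Set E) (f : E → ℝ) : ℝ :=
  sInf {M : ℝ | ∀ᵐ x ∂(μ.restrict A), |f x| ≤ M}

/-- `M_n(f)(x) = max_{1 ≤ k ≤ n} |f (Tᵏ x)|`, the empty maximum being `0`. -/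
noncomputable def partialMax (T : E → E) (f : E → ℝ) (n : ℕ) (x : E) : ℝ :=
  (((Finset.Icc 1 n).sup fun k => ‖f (T^[k] x)‖₊ : ℝ≥0) : ℝ)

end Ergodic

/-! ### The space `D[0,1]` with the Skorohod `M₁` topology -/

/-- `D[0,1]`: real functions on `[0,1]` that are right-continuous and have left limits.
(The left-limit condition is void at `0`, and a jump at `1` is allowed.) -/
structure SkorohodD where
  toFun : I → ℝ
  rightCont : ∀ t, ContinuousWithinAt toFun (Ici t) t
  leftLimit : ∀ t, ∃ l, Tendsto toFun (𝓝[<] t) (𝓝 l)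

namespace SkorohodD

/-- The left limit `x(t-)`, with the convention `x(0-) = x(0)`. -/
noncomputable def left (x : SkorohodD) (t : I) : ℝ := Function.leftLim x.toFun t

/-- The completed graph `{(z, t) : z` lies on the segment between `x(t-)` and `x(t)}`. -/
def completedGraph (x : SkorohodD) : Set (ℝ × I) :=
  {p | p.1 ∈ segment ℝ (x.left p.2) (x.toFun p.2)}

/-- The order on the completed graph: from left to right, and along each vertical segment from
`x(t-)` to `x(t)`. -/
def graphLE (x : SkorohodD) (p q : ℝ × I) : Prop :=
  p.2 < q.2 ∨ (p.2 = q.2 ∧ |x.left p.2 - p.1| ≤ |x.left p.2 - q.1|)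

/-- The parametric representations `(u, r)` of `x`: continuous maps of `[0,1]` onto the completed
graph that are nondecreasing for its order. -/
def parametricRep (x : SkorohodD) : Set C(I, ℝ × I) :=
  {γ | range γ = x.completedGraph ∧ ∀ s s' : I, s ≤ s' → x.graphLE (γ s) (γ s')}

/-- The `M₁` distance: the infimum of `max (‖u₁ - u₂‖_∞) (‖r₁ - r₂‖_∞)` over parametric
representations `(u₁, r₁)` of `x` and `(u₂, r₂)` of `y`. (The extended distance on `C(I, ℝ × I)`
is the supremum over `s` of the larger of the two coordinate distances.) -/
noncomputable def m1Dist (x y : SkorohodD) : ℝ≥0∞ :=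
  ⨅ (γ ∈ x.parametricRep) (δ ∈ y.parametricRep), edist γ δ

/-- The `M₁` topology, that is, the topology of the metric `m1Dist`: a set is open if it contains,
with each of its points, a ball around this point. -/
instance instTopologicalSpace : TopologicalSpace SkorohodD where
  IsOpen U := ∀ x ∈ U, ∃ ε : ℝ≥0∞, 0 < ε ∧ ∀ y, m1Dist x y < ε → y ∈ U
  isOpen_univ := fun _ _ => ⟨1, one_pos, fun _ _ => mem_univ _⟩
  isOpen_inter := by
    rintro U V hU hV x ⟨hxU, hxV⟩
    obtain ⟨ε, hε, h⟩ := hU x hxU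
    obtain ⟨δ, hδ, h'⟩ := hV x hxV
    exact ⟨min ε δ, lt_min hε hδ, fun y hy =>
      ⟨h y (hy.trans_le (min_le_left _ _)), h' y (hy.trans_le (min_le_right _ _))⟩⟩
  isOpen_sUnion := by
    rintro S hS x ⟨U, hU, hxU⟩
    obtain ⟨ε, hε, h⟩ := hS U hU x hxU
    exact ⟨ε, hε, fun y hy => ⟨U, hU, h y hy⟩⟩

/-- The Borel σ-algebra of the `M₁` topology. -/
instance instMeasurableSpace : MeasurableSpace SkorohodD := borel SkorohodD

instance instBorelSpace : BorelSpace SkorohodD := ⟨rfl⟩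

end SkorohodD

/-! ### The processes -/

/-- The path `t ↦ M_{⌊n t⌋}(f)(x)`, `0 ≤ t ≤ 1`, as an element of `D[0,1]`. -/
noncomputable def maxPath {E : Type*} (T : E → E) (f : E → ℝ) (n : ℕ) (x : E) : SkorohodD where
  toFun t := partialMax T f ⌊(n : ℝ) * (t : ℝ)⌋₊ x
  rightCont := by
    intro t
    have hc : Tendsto (fun s : I => (n : ℝ) * (s : ℝ)) (𝓝[≥] t) (𝓝 ((n : ℝ) * (t : ℝ))) :=
      (by fun_prop : Continuous fun s : I => (n : ℝ) * (s : ℝ)).continuousWithinAt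
    have h1 : ∀ᶠ s : I in 𝓝[≥] t,
        (n : ℝ) * (s : ℝ) < (⌊(n : ℝ) * (t : ℝ)⌋₊ : ℝ) + 1 :=
      hc.eventually_lt_const (Nat.lt_floor_add_one _)
    have h2 : ∀ᶠ s : I in 𝓝[≥] t,
        partialMax T f ⌊(n : ℝ) * (t : ℝ)⌋₊ x = partialMax T f ⌊(n : ℝ) * (s : ℝ)⌋₊ x := by
      filter_upwards [h1, self_mem_nhdsWithin] with s hs hts
      have hts' : (t : ℝ) ≤ (s : ℝ) := hts
      have hle : (n : ℝ) * (t : ℝ) ≤ (n : ℝ) * (s : ℝ) := by gcongr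
      have h0 : (0 : ℝ) ≤ (n : ℝ) * (t : ℝ) := mul_nonneg n.cast_nonneg t.2.1
      have he : ⌊(n : ℝ) * (s : ℝ)⌋₊ = ⌊(n : ℝ) * (t : ℝ)⌋₊ :=
        (Nat.floor_eq_iff (h0.trans hle)).2 ⟨(Nat.floor_le h0).trans hle, hs⟩
      rw [he]
    exact tendsto_const_nhds.congr' h2
  leftLimit := by
    intro t
    have hm : Monotone fun s : I => partialMax T f ⌊(n : ℝ) * (s : ℝ)⌋₊ x := by
      intro s s' hs
      have hs' : (s : ℝ) ≤ (s' : ℝ) := hs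
      have hf : ⌊(n : ℝ) * (s : ℝ)⌋₊ ≤ ⌊(n : ℝ) * (s' : ℝ)⌋₊ := Nat.floor_mono (by gcongr)
      exact NNReal.coe_le_coe.2 (Finset.sup_mono (Finset.Icc_subset_Icc le_rfl hf))
    exact ⟨_, hm.tendsto_leftLim t⟩

open Classical in
/-- The path `t ↦ c · 1{v ≤ t}`, `0 ≤ t ≤ 1`, as an element of `D[0,1]`. -/
noncomputable def stepPath (c v : ℝ) : SkorohodD where
  toFun t := c * (if v ≤ (t : ℝ) then 1 else 0)
  rightCont := by
    intro t
    have hc : Tendsto (fun s : I => (s : ℝ)) (𝓝[≥] t) (𝓝 (t : ℝ)) :=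
      continuous_subtype_val.continuousWithinAt
    by_cases h : v ≤ (t : ℝ)
    · refine tendsto_const_nhds.congr' ?_
      filter_upwards [self_mem_nhdsWithin] with s hs
      have hs' : (t : ℝ) ≤ (s : ℝ) := hs
      simp [h, h.trans hs']
    · refine tendsto_const_nhds.congr' ?_
      filter_upwards [hc.eventually_lt_const (not_le.1 h)] with s hs
      simp [h, not_le.2 hs]
  leftLimit := by
    intro t
    have hc : Tendsto (fun s : I => (s : ℝ)) (𝓝[<] t) (𝓝 (t : ℝ)) :=
      continuous_subtype_val.continuousWithinAt
    by_cases h : v < (t : ℝ)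
    · refine ⟨c * 1, tendsto_const_nhds.congr' ?_⟩
      filter_upwards [hc.eventually_const_lt h] with s hs
      simp [hs.le]
    · refine ⟨c * 0, tendsto_const_nhds.congr' ?_⟩
      filter_upwards [self_mem_nhdsWithin] with s hs
      have hs' : (s : ℝ) < (t : ℝ) := hs
      simp [hs'.trans_le (not_lt.1 h)]

end MaxErgodic

/-!
The argument has three parts.

*Wandering rate.* Put `q j = μ(A ∩ {φ_A > j})`, so that `μ(φ_A ≤ n) = ∑_{j < n} q j`. Splitting
`{φ_A ≤ n}` according to the last visit to `A` and summing over `n` gives the exact identity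
`∑_{n ≤ N} ∫_{φ_A ≤ n} g dμ = ∑_{j < N} ∫_{A ∩ {φ_A > j}} ∑_{k=1}^{N-j} T̂ᵏ g dμ`
(`sum_setIntegral_entranceSet`). As `A` is uniform and almost every orbit visits `A`, this becomes the
renewal relation `∑_{j < N} q j a (N - j) ∼ N` (`tendsto_renewalSum`). An elementary Tauberian
argument, by convolution with the Abel kernel `u ^ (β - 1)` and differentiation of monotone
asymptotics, yields `μ(φ_A ≤ n) ∼ C n / a n` with `C` depending on `β` only (`tendsto_sum_mul_div`).
Hence `μ_n(φ_A ≤ n t) → t ^ β`. A subset `B` of `A` of positive measure inherits uniformity, so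
that it has the same wandering rate as `A`. Therefore, after the orbit has entered `A`, it visits `B`
at a time that is negligible on the scale `n` (`tendsto_measure_ratio`).

*Topology.* The completed graph of a monotone path is a chain in the plane, and it is parametrized by
the antidiagonal coordinate `z + t`. Therefore closeness of completed graphs implies closeness in the
`M₁` distance (`SkorohodD.m1Dist_le`). In particular, a path that vanishes until shortly before `v`
and is almost `c` shortly after `v` is close to the step of height `c` at `v`
(`SkorohodD.NearStep.m1Dist_le`).

*Weak convergence.* Before time `φ_A` the maximum is `0`. With `B` the part of `A` where `|f|` is
almost `‖f‖_∞`, it is almost `‖f‖_∞` from the first visit to `B` on. So the path is close to a step at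
`φ_A / n`. The portmanteau criterion for an open set `U` is checked by cutting `(0, 1]` into small cells
and keeping the cells that contain a time `v` for which all paths close to the step at `v` are in `U`
(`measure_stepPath_le_iSup`, `measure_mem_le_sum`, `ofReal_sum_le_entranceMeasure`). Only upper
bounds for the `M₁` distance are used; that it is a metric is not needed.
-/

namespace MaxErgodic

/-! ### A Tauberian theorem by Abel inversion -/

/-- Monotone functions on `[0, 1]` that converge pointwise to a linear function converge uniformly:
it is enough to compare on a fine finite grid. -/
theorem tendstoUniformlyOn_of_monotoneOn_of_linear {F : ℕ → ℝ → ℝ} {b : ℝ}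
    (hF : ∀ n, MonotoneOn (F n) (Icc 0 1))
    (hlim : ∀ r ∈ Icc (0 : ℝ) 1, Tendsto (fun n => F n r) atTop (𝓝 (b * r))) :
    TendstoUniformlyOn F (fun r => b * r) atTop (Icc 0 1) := by
  have hb : 0 ≤ b := by
    have h0 := hlim 0 (by simp)
    have h1 := hlim 1 (by simp)
    have := le_of_tendsto_of_tendsto' h0 h1 fun n => hF n (by simp) (by simp) zero_le_one
    simpa using this
  rw [Metric.tendstoUniformlyOn_iff]
  intro ε hε
  obtain ⟨m, hm⟩ := exists_nat_gt (2 * b / ε)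
  have hm0 : (0 : ℝ) < m + 1 := by positivity
  have hbm : b / (m + 1) < ε / 2 := by
    rw [div_lt_iff₀ hm0]
    rw [div_lt_iff₀ hε] at hm
    nlinarith
  have hgrid : ∀ᶠ n in atTop, ∀ i ∈ Finset.range (m + 2),
      |F n ((i : ℝ) / (m + 1)) - b * ((i : ℝ) / (m + 1))| < ε / 2 := by
    rw [Filter.eventually_all_finset]
    intro i hi
    have hi' : (i : ℝ) ≤ m + 1 := by
      have := Finset.mem_range.1 hi
      exact_mod_cast Nat.lt_succ_iff.1 this
    have := hlim ((i : ℝ) / (m + 1)) ⟨by positivity, by rw [div_le_one hm0]; exact hi'⟩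
    have := Metric.tendsto_atTop.1 this (ε / 2) (by positivity)
    simpa [Real.dist_eq, eventually_atTop] using this
  filter_upwards [hgrid] with n hn r hr
  set i := ⌊r * (m + 1)⌋₊ with hidef
  rcases hr.2.eq_or_lt with rfl | hr1
  · have := hn (m + 1) (by simp)
    push_cast at this
    rw [div_self hm0.ne'] at this
    rw [Real.dist_eq, abs_sub_comm]
    linarith
  have hr0 : 0 ≤ r * (m + 1) := mul_nonneg hr.1 hm0.le
  have hi1 : (i : ℝ) ≤ r * (m + 1) := Nat.floor_le hr0
  have hi2 : r * (m + 1) < i + 1 := Nat.lt_floor_add_one _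
  have hi3 : i < m + 1 := by
    have : (i : ℝ) < m + 1 := by nlinarith
    exact_mod_cast this
  have hi4 : (i : ℝ) + 1 ≤ m + 1 := by exact_mod_cast hi3
  have e1 := abs_lt.1 (hn i (by simp; omega))
  have e2 := abs_lt.1 (hn (i + 1) (by simp; omega))
  push_cast at e2
  have l1 : (i : ℝ) / (m + 1) ≤ r := by rw [div_le_iff₀ hm0]; exact hi1
  have l2 : r ≤ ((i : ℝ) + 1) / (m + 1) := by rw [le_div_iff₀ hm0]; exact hi2.le
  have l3 : ((i : ℝ) + 1) / (m + 1) ≤ 1 := by rw [div_le_one hm0]; exact hi4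
  have m1 := hF n (a := (i : ℝ) / (m + 1)) ⟨by positivity, l1.trans hr.2⟩ hr l1
  have m2 := hF n hr (b := ((i : ℝ) + 1) / (m + 1)) ⟨by positivity, l3⟩ l2
  have k1 : b * (((i : ℝ) + 1) / (m + 1)) = b * ((i : ℝ) / (m + 1)) + b / (m + 1) := by ring
  have k2 := mul_le_mul_of_nonneg_left l1 hb
  have k3 := mul_le_mul_of_nonneg_left l2 hb
  rw [Real.dist_eq, abs_lt]
  constructor <;> linarith

/-- The Abel integral `∫₀^r u ^ (β - 1) h_N(r - u) du` of the rescaled sequence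
`h_N(s) = a ⌊s N⌋ / a N`, written after the substitution `u = r v`. -/
noncomputable def abelAverage (a : ℕ → ℝ) (β : ℝ) (N : ℕ) (r : ℝ) : ℝ :=
  r ^ β * ∫ v in (0 : ℝ)..1, v ^ (β - 1) * (a ⌊r * (1 - v) * N⌋₊ / a N)

/-- The Beta integral `B(β, 2 - β)`: the value at `r = 1` of the Abel integral of
`s ↦ s ^ (1 - β)`. -/
noncomputable def abelConst (β : ℝ) : ℝ := ∫ v in (0 : ℝ)..1, v ^ (β - 1) * (1 - v) ^ (1 - β)

section
variable {a q : ℕ → ℝ} {β : ℝ}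

theorem measurable_floor_comp (a : ℕ → ℝ) {g : ℝ → ℝ} (hg : Measurable g) :
    Measurable fun v => a ⌊g v⌋₊ :=
  (measurable_from_nat (f := a)).comp (Nat.measurable_floor.comp hg)

theorem ae_mem_Ioo_of_uIoc :
    ∀ᵐ v : ℝ, v ∈ Set.uIoc (0:ℝ) 1 → v ∈ Set.Ioo (0:ℝ) 1 := by
  have : ∀ᵐ v : ℝ, v ≠ 1 := by simp [ae_iff]
  filter_upwards [this] with v hv h
  rw [uIoc_of_le zero_le_one] at h
  exact ⟨h.1, lt_of_le_of_ne h.2 hv⟩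

theorem intervalIntegrable_rpow_mul_of_bounded (hβ : 0 < β) {g : ℝ → ℝ} (hg : Measurable g) {C : ℝ}
    (hC : ∀ v ∈ Ioc (0 : ℝ) 1, |g v| ≤ C) :
    IntervalIntegrable (fun v => v ^ (β - 1) * g v) volume 0 1 := by
  have h1 : IntervalIntegrable (fun v : ℝ => v ^ (β - 1)) volume 0 1 :=
    intervalIntegral.intervalIntegrable_rpow' (by linarith)
  rw [intervalIntegrable_iff_integrableOn_Ioc_of_le zero_le_one] at h1 ⊢
  refine Integrable.mul_bdd (c := C) h1 hg.aestronglyMeasurable ?_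
  filter_upwards [ae_restrict_mem measurableSet_Ioc] with v hv using hC v hv

theorem abelConst_pos (hβ : 0 < β) (hβ1 : β ≤ 1) : 0 < abelConst β := by
  refine intervalIntegral.intervalIntegral_pos_of_pos_on ?_ ?_ zero_lt_one
  · refine intervalIntegrable_rpow_mul_of_bounded hβ (by fun_prop) (C := 1) ?_
    intro v hv
    have h : 0 ≤ 1 - v := by linarith [hv.2]
    rw [abs_of_nonneg (Real.rpow_nonneg h _)]
    exact Real.rpow_le_one h (by linarith [hv.1]) (by linarith)
  · intro v hv
    have : 0 < 1 - v := by linarith [hv.2]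
    have := hv.1
    positivity

theorem abs_div_le_one (ha : Monotone a) (ha0 : a 0 = 0) {m N : ℕ} (h : m ≤ N) :
    |a m / a N| ≤ 1 := by
  have h1 : 0 ≤ a m := ha0 ▸ ha (Nat.zero_le m)
  have h2 : 0 ≤ a N := ha0 ▸ ha (Nat.zero_le N)
  rw [abs_of_nonneg (div_nonneg h1 h2)]
  exact div_le_one_of_le₀ (ha h) h2

theorem floor_le_of_mem {r v : ℝ} (hr : r ∈ Icc (0 : ℝ) 1) (hv : v ∈ Icc (0 : ℝ) 1) (N : ℕ) :
    ⌊r * (1 - v) * N⌋₊ ≤ N := by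
  refine Nat.floor_le_of_le ?_
  have : r * (1 - v) ≤ 1 := by nlinarith [hr.1, hr.2, hv.1, hv.2]
  have hN : (0 : ℝ) ≤ N := N.cast_nonneg
  nlinarith

theorem intervalIntegrable_abel (hβ : 0 < β) (ha : Monotone a) (ha0 : a 0 = 0) (N : ℕ) {r : ℝ}
    (hr : r ∈ Icc (0 : ℝ) 1) :
    IntervalIntegrable (fun v => v ^ (β - 1) * (a ⌊r * (1 - v) * N⌋₊ / a N)) volume 0 1 :=
  intervalIntegrable_rpow_mul_of_bounded hβ
    ((measurable_floor_comp a (by fun_prop)).div_const _)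
    fun _ hv => abs_div_le_one ha ha0 (floor_le_of_mem hr ⟨hv.1.le, hv.2⟩ N)

theorem monotoneOn_abelAverage (hβ : 0 < β) (ha : Monotone a) (ha0 : a 0 = 0) (N : ℕ) :
    MonotoneOn (abelAverage a β N) (Icc 0 1) := by
  intro r hr r' hr' hrr'
  have hnn : ∀ m, 0 ≤ a m := fun m => ha0 ▸ ha (Nat.zero_le m)
  refine mul_le_mul (Real.rpow_le_rpow hr.1 hrr' hβ.le) ?_ ?_ (Real.rpow_nonneg hr'.1 _)
  · refine intervalIntegral.integral_mono_on zero_le_one (intervalIntegrable_abel hβ ha ha0 N hr)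
      (intervalIntegrable_abel hβ ha ha0 N hr') fun v hv => ?_
    have : 0 ≤ 1 - v := by linarith [hv.2]
    have h1 : a ⌊r * (1 - v) * N⌋₊ ≤ a ⌊r' * (1 - v) * N⌋₊ := ha (Nat.floor_mono (by gcongr))
    have h2 := Real.rpow_nonneg hv.1 (β - 1)
    have h3 := hnn N
    gcongr
  · refine intervalIntegral.integral_nonneg zero_le_one fun v hv => ?_
    exact mul_nonneg (Real.rpow_nonneg hv.1 _) (div_nonneg (hnn _) (hnn _))

theorem tendsto_abelAverage (hβ : 0 < β) (ha : Monotone a) (ha0 : a 0 = 0)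
    (hrv : IsRegularlyVarying a (1 - β)) {r : ℝ} (hr : r ∈ Icc (0 : ℝ) 1) :
    Tendsto (fun N => abelAverage a β N r) atTop (𝓝 (abelConst β * r)) := by
  rcases hr.1.eq_or_lt with rfl | hr0
  · simp [abelAverage, Real.zero_rpow hβ.ne']
  have key : Tendsto (fun N : ℕ => ∫ v in (0 : ℝ)..1, v ^ (β - 1) * (a ⌊r * (1 - v) * N⌋₊ / a N))
      atTop (𝓝 (∫ v in (0 : ℝ)..1, v ^ (β - 1) * (r * (1 - v)) ^ (1 - β))) := by
    refine intervalIntegral.tendsto_integral_filter_of_dominated_convergence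
      (fun v : ℝ => v ^ (β - 1)) ?_ ?_ ?_ ?_
    · refine Eventually.of_forall fun N => ?_
      exact ((by fun_prop : Measurable fun v : ℝ => v ^ (β - 1)).mul
        ((measurable_floor_comp a (by fun_prop)).div_const _)).aestronglyMeasurable
    · refine Eventually.of_forall fun N => ?_
      filter_upwards [ae_mem_Ioo_of_uIoc] with v hv hv'
      have hv := hv hv'
      have h0 := Real.rpow_nonneg hv.1.le (β - 1)
      rw [norm_mul, Real.norm_of_nonneg h0]
      exact mul_le_of_le_one_right h0
        (abs_div_le_one ha ha0 (floor_le_of_mem hr ⟨hv.1.le, hv.2.le⟩ N))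
    · exact intervalIntegral.intervalIntegrable_rpow' (by linarith)
    · filter_upwards [ae_mem_Ioo_of_uIoc] with v hv hv'
      have hv := hv hv'
      exact (hrv.2 (r * (1 - v)) (mul_pos hr0 (by linarith [hv.2]))).const_mul _
  have h2 : r ^ β * ∫ v in (0 : ℝ)..1, v ^ (β - 1) * (r * (1 - v)) ^ (1 - β) = abelConst β * r := by
    rw [abelConst, mul_comm _ r, ← intervalIntegral.integral_const_mul,
      ← intervalIntegral.integral_const_mul]
    refine intervalIntegral.integral_congr fun v hv => ?_
    rw [uIcc_of_le zero_le_one] at hv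
    have h3 : r ^ β * r ^ (1 - β) = r := by rw [← Real.rpow_add hr0]; simp
    simp only [Real.mul_rpow hr0.le (by linarith [hv.2] : 0 ≤ 1 - v)]
    linear_combination (v ^ (β - 1) * (1 - v) ^ (1 - β)) * h3
  rw [← h2]
  exact key.const_mul _


/-- The convolution `∑_{j < n} q j * a (n - j)`. -/
noncomputable def renewalSum (a q : ℕ → ℝ) (n : ℕ) : ℝ := ∑ j ∈ Finset.range n, q j * a (n - j)

/-- Truncated subtraction is harmless in the convolution, because `a 0 = 0`. -/
theorem renewalSum_eq_of_le (ha0 : a 0 = 0) {m N : ℕ} (h : m ≤ N) :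
    renewalSum a q m = ∑ j ∈ Finset.range N, q j * a (m - j) := by
  refine Finset.sum_subset (Finset.range_mono h) fun j _ hj => ?_
  rw [Nat.sub_eq_zero_of_le (by simpa using hj), ha0, mul_zero]

/-- Integrating the delayed sequence `u ↦ a (⌊(1 - u) N⌋ - j)` against the Abel kernel gives an Abel
average at `1 - j / N`, exactly: the integrand vanishes for `u ≥ 1 - j / N`, and `j` is an integer,
so that it passes through the floor. -/
theorem integral_abel_shift (hβ : 0 < β) (ha : Monotone a) (ha0 : a 0 = 0) {j N : ℕ} (hj : j < N) :
    IntervalIntegrable (fun u => u ^ (β - 1) * a (⌊(1 - u) * N⌋₊ - j)) volume 0 1 ∧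
    a N * abelAverage a β N (1 - j / N) =
      ∫ u in (0 : ℝ)..1, u ^ (β - 1) * a (⌊(1 - u) * N⌋₊ - j) := by
  have hnn : ∀ m, 0 ≤ a m := fun m => ha0 ▸ ha (Nat.zero_le m)
  have hN : (0 : ℝ) < N := by exact_mod_cast (Nat.zero_le j).trans_lt hj
  have hjN : (j : ℝ) < N := by exact_mod_cast hj
  set r : ℝ := 1 - j / N with hr
  have hr0 : 0 < r := by rw [hr, sub_pos, div_lt_one hN]; exact hjN
  have hr1 : r ≤ 1 := by rw [hr]; linarith [div_nonneg (Nat.cast_nonneg (α := ℝ) j) hN.le]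
  have hrN : r * N = N - j := by rw [hr]; field_simp
  have hint : IntervalIntegrable (fun u => u ^ (β - 1) * a (⌊(1 - u) * N⌋₊ - j)) volume 0 1 := by
    refine intervalIntegrable_rpow_mul_of_bounded hβ
      (measurable_floor_comp (fun m => a (m - j)) (by fun_prop)) (C := a N) fun v hv => ?_
    rw [abs_of_nonneg (hnn _)]
    refine ha ((Nat.sub_le _ _).trans ?_)
    simpa using floor_le_of_mem (r := 1) (by simp) ⟨hv.1.le, hv.2⟩ N
  refine ⟨hint, ?_⟩
  have hsub : uIcc 0 r ⊆ uIcc (0 : ℝ) 1 := by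
    rw [uIcc_of_le hr0.le, uIcc_of_le zero_le_one]; exact Icc_subset_Icc le_rfl hr1
  have hsub' : uIcc r 1 ⊆ uIcc (0 : ℝ) 1 := by
    rw [uIcc_of_le hr1, uIcc_of_le zero_le_one]; exact Icc_subset_Icc hr0.le le_rfl
  rw [← intervalIntegral.integral_add_adjacent_intervals (hint.mono_set hsub)
    (hint.mono_set hsub')]
  have h2 : ∫ u in r..1, u ^ (β - 1) * a (⌊(1 - u) * N⌋₊ - j) = 0 := by
    rw [← intervalIntegral.integral_zero (a := r) (b := 1)]
    refine intervalIntegral.integral_congr fun u hu => ?_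
    rw [uIcc_of_le hr1] at hu
    have : ⌊(1 - u) * N⌋₊ ≤ j := by
      refine Nat.floor_le_of_le ?_
      nlinarith [hu.1]
    simp [Nat.sub_eq_zero_of_le this, ha0]
  have h1 := intervalIntegral.integral_comp_mul_left (a := 0) (b := 1)
    (fun u => u ^ (β - 1) * a (⌊(1 - u) * N⌋₊ - j)) hr0.ne'
  rw [mul_zero, mul_one, smul_eq_mul, inv_mul_eq_div, eq_div_iff hr0.ne'] at h1
  rw [h2, add_zero, ← h1, abelAverage]
  have h3 : ∀ v ∈ uIcc (0 : ℝ) 1, a N * (v ^ (β - 1) * (a ⌊r * (1 - v) * N⌋₊ / a N)) * r ^ (β - 1) =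
      (r * v) ^ (β - 1) * a (⌊(1 - r * v) * N⌋₊ - j) := by
    intro v hv
    rw [uIcc_of_le zero_le_one] at hv
    have e : ⌊(1 - r * v) * N⌋₊ - j = ⌊r * (1 - v) * N⌋₊ := by
      rw [← Nat.floor_sub_natCast]
      congr 1
      linear_combination (-1 : ℝ) * hrN
    rw [e, Real.mul_rpow hr0.le hv.1]
    rcases eq_or_ne (a N) 0 with h0 | h0
    · have : a ⌊r * (1 - v) * N⌋₊ = 0 :=
        le_antisymm (h0 ▸ ha (floor_le_of_mem ⟨hr0.le, hr1⟩ hv N)) (hnn _)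
      simp [h0, this]
    · field_simp
  rw [← intervalIntegral.integral_congr h3, intervalIntegral.integral_mul_const,
    intervalIntegral.integral_const_mul]
  have h4 : r ^ β = r ^ (β - 1) * r := by
    rw [Real.rpow_sub_one hr0.ne']; field_simp
  rw [h4]; ring

theorem exists_bound_renewal (hκ : Tendsto (fun n : ℕ => renewalSum a q n / n) atTop (𝓝 1)) :
    ∃ C : ℝ, 0 ≤ C ∧ ∀ n : ℕ, |renewalSum a q n| ≤ C * n := by
  obtain ⟨C, hC⟩ := hκ.abs.bddAbove_range
  refine ⟨C, (abs_nonneg _).trans (hC ⟨0, rfl⟩), fun n => ?_⟩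
  rcases n.eq_zero_or_pos with rfl | hn
  · simp [renewalSum]
  have := hC ⟨n, rfl⟩
  have hn' : (0 : ℝ) < n := by exact_mod_cast hn
  simpa [abs_div, div_le_iff₀ hn'] using this

/-- The rescaled convolutions converge to the identity, hence so do their integrals against the Abel
kernel. -/
theorem tendsto_integral_renewal (hβ : 0 < β)
    (hκ : Tendsto (fun n : ℕ => renewalSum a q n / n) atTop (𝓝 1)) :
    Tendsto (fun N : ℕ => ∫ u in (0 : ℝ)..1, u ^ (β - 1) * (renewalSum a q ⌊(1 - u) * N⌋₊ / N)) atTop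
      (𝓝 (∫ u in (0 : ℝ)..1, u ^ (β - 1) * (1 - u))) := by
  obtain ⟨C, hC0, hC⟩ := exists_bound_renewal hκ
  refine intervalIntegral.tendsto_integral_filter_of_dominated_convergence
      (fun v : ℝ => C * v ^ (β - 1)) ?_ ?_ ?_ ?_
  · refine Eventually.of_forall fun N => ?_
    exact ((by fun_prop : Measurable fun v : ℝ => v ^ (β - 1)).mul
      ((measurable_floor_comp (renewalSum a q) (by fun_prop)).div_const _)).aestronglyMeasurable
  · refine Eventually.of_forall fun N => ?_
    filter_upwards [ae_mem_Ioo_of_uIoc] with v hv hv'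
    have hv := hv hv'
    have h0 := Real.rpow_nonneg hv.1.le (β - 1)
    rw [norm_mul, Real.norm_of_nonneg h0, mul_comm]
    refine mul_le_mul_of_nonneg_right ?_ h0
    rw [Real.norm_eq_abs, abs_div, Nat.abs_cast]
    refine div_le_of_le_mul₀ N.cast_nonneg hC0 ((hC _).trans ?_)
    have := floor_le_of_mem (r := 1) (by simp) ⟨hv.1.le, hv.2.le⟩ N
    rw [one_mul] at this
    gcongr
  · exact (intervalIntegral.intervalIntegrable_rpow' (by linarith)).const_mul C
  · filter_upwards [ae_mem_Ioo_of_uIoc] with v hv hv'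
    have hv := hv hv'
    refine Tendsto.const_mul _ ?_
    have hv1 : 0 < 1 - v := by linarith [hv.2]
    have hf : Tendsto (fun N : ℕ => ⌊(1 - v) * (N : ℝ)⌋₊) atTop atTop :=
      tendsto_nat_floor_atTop.comp (tendsto_natCast_atTop_atTop.const_mul_atTop hv1)
    have h2 : Tendsto (fun N : ℕ => (⌊(1 - v) * (N : ℝ)⌋₊ : ℝ) / N) atTop (𝓝 (1 - v)) :=
      (tendsto_nat_floor_mul_div_atTop hv1.le).comp tendsto_natCast_atTop_atTop
    have h3 := (hκ.comp hf).mul h2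
    rw [one_mul] at h3
    refine h3.congr' ?_
    filter_upwards [hf.eventually_gt_atTop 0] with N hN
    have : (0 : ℝ) < ⌊(1 - v) * (N : ℝ)⌋₊ := by exact_mod_cast hN
    simp only [Function.comp_apply]
    field_simp

/-- The limit of the second-order sums in `tendsto_weighted_sum`, that is,
`B(β, 2) / B(β, 2 - β)`. -/
noncomputable def tauberConst (β : ℝ) : ℝ := (∫ u in (0 : ℝ)..1, u ^ (β - 1) * (1 - u)) / abelConst β

theorem tauberConst_pos (hβ : 0 < β) (hβ1 : β ≤ 1) : 0 < tauberConst β := by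
  refine div_pos (intervalIntegral.intervalIntegral_pos_of_pos_on ?_ ?_ zero_lt_one)
    (abelConst_pos hβ hβ1)
  · refine intervalIntegrable_rpow_mul_of_bounded hβ (by fun_prop) (C := 1) ?_
    intro v hv
    rw [abs_le]; constructor <;> linarith [hv.1, hv.2]
  · intro v hv
    have : 0 < 1 - v := by linarith [hv.2]
    have := hv.1
    positivity

/-- Discrete Abel inversion. If `(q * a)(n) ∼ n` and `a` is regularly varying with exponent `1 - β`,
then the convolution of `q * a` with the kernel `u ^ (β - 1)` is on one hand explicit, and on the
other hand the convolution of `q` with the Abel averages of `a`, which are uniformly close to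
linear functions. This gives the asymptotics of the second-order sums of `q`. -/
theorem tendsto_weighted_sum (hβ : 0 < β) (hβ1 : β ≤ 1) (ha : Monotone a) (ha0 : a 0 = 0)
    (hrv : IsRegularlyVarying a (1 - β)) (hq : ∀ j, 0 ≤ q j)
    (hκ : Tendsto (fun n : ℕ => renewalSum a q n / n) atTop (𝓝 1)) :
    Tendsto (fun N : ℕ => a N / N * ∑ j ∈ Finset.range N, q j * (1 - j / N)) atTop
      (𝓝 (tauberConst β)) := by
  have hnn : ∀ m, 0 ≤ a m := fun m => ha0 ▸ ha (Nat.zero_le m)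
  have hB := abelConst_pos hβ hβ1
  obtain ⟨C, hC0, hC⟩ := exists_bound_renewal hκ
  -- the total mass of the rescaled `q` is bounded: look at the convolution at `2 N`
  have hmass : ∀ N : ℕ, 0 < N → a N / N * ∑ j ∈ Finset.range N, q j ≤ C * 2 := by
    intro N hN
    have hN' : (0 : ℝ) < N := by exact_mod_cast hN
    rw [div_mul_eq_mul_div, div_le_iff₀ hN', mul_comm (a N), Finset.sum_mul]
    calc ∑ j ∈ Finset.range N, q j * a N ≤ ∑ j ∈ Finset.range N, q j * a (2 * N - j) := by
          refine Finset.sum_le_sum fun j hj => mul_le_mul_of_nonneg_left (ha ?_) (hq j)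
          have := Finset.mem_range.1 hj
          omega
      _ ≤ renewalSum a q (2 * N) :=
          Finset.sum_le_sum_of_subset_of_nonneg (Finset.range_mono (by omega))
            fun j _ _ => mul_nonneg (hq j) (hnn _)
      _ ≤ C * (2 * N : ℕ) := (le_abs_self _).trans (hC _)
      _ = C * 2 * N := by push_cast; ring
  have hid : ∀ N : ℕ, ∫ u in (0 : ℝ)..1, u ^ (β - 1) * (renewalSum a q ⌊(1 - u) * N⌋₊ / N) =
      a N / N * ∑ j ∈ Finset.range N, q j * abelAverage a β N (1 - j / N) := by
    intro N
    rw [Finset.mul_sum]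
    have e : ∀ u ∈ uIcc (0 : ℝ) 1, u ^ (β - 1) * (renewalSum a q ⌊(1 - u) * N⌋₊ / N) =
        ∑ j ∈ Finset.range N, q j / N * (u ^ (β - 1) * a (⌊(1 - u) * N⌋₊ - j)) := by
      intro u hu
      rw [uIcc_of_le zero_le_one] at hu
      have := floor_le_of_mem (r := 1) (by simp) hu N
      rw [one_mul] at this
      rw [renewalSum_eq_of_le ha0 this, Finset.sum_div, Finset.mul_sum]
      refine Finset.sum_congr rfl fun j _ => ?_
      ring
    rw [intervalIntegral.integral_congr e, intervalIntegral.integral_finsetSum]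
    · refine Finset.sum_congr rfl fun j hj => ?_
      rw [intervalIntegral.integral_const_mul,
        ← (integral_abel_shift hβ ha ha0 (Finset.mem_range.1 hj)).2]
      ring
    · intro j hj
      exact (integral_abel_shift hβ ha ha0 (Finset.mem_range.1 hj)).1.const_mul _
  have h1 := (tendsto_integral_renewal hβ hκ).congr hid
  have hunif := tendstoUniformlyOn_of_monotoneOn_of_linear (fun N => monotoneOn_abelAverage hβ ha ha0 N)
    fun r hr => tendsto_abelAverage hβ ha ha0 hrv hr
  have hdiff : Tendsto (fun N : ℕ =>
      a N / N * ∑ j ∈ Finset.range N, q j * abelAverage a β N (1 - j / N) -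
      abelConst β * (a N / N * ∑ j ∈ Finset.range N, q j * (1 - j / N))) atTop (𝓝 0) := by
    rw [Metric.tendsto_atTop]
    intro ε hε
    rw [Metric.tendstoUniformlyOn_iff] at hunif
    have hC1 : 0 < C * 2 + 1 := by linarith
    obtain ⟨N0, hN0⟩ := eventually_atTop.1 (hunif (ε / (C * 2 + 1)) (by positivity))
    refine ⟨N0 + 1, fun N hN => ?_⟩
    have hNpos : 0 < N := by omega
    have hN' : (0 : ℝ) < N := by exact_mod_cast hNpos
    have e : a N / N * ∑ j ∈ Finset.range N, q j * abelAverage a β N (1 - j / N) -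
      abelConst β * (a N / N * ∑ j ∈ Finset.range N, q j * (1 - j / N)) =
      a N / N * ∑ j ∈ Finset.range N,
        q j * (abelAverage a β N (1 - j / N) - abelConst β * (1 - j / N)) := by
      rw [mul_left_comm, ← mul_sub, Finset.mul_sum, ← Finset.sum_sub_distrib]
      congr 1
      exact Finset.sum_congr rfl fun j _ => by ring
    have hA : 0 ≤ a N / N := div_nonneg (hnn _) hN'.le
    rw [dist_zero_right, e, norm_mul, Real.norm_of_nonneg hA]
    calc a N / N * ‖∑ j ∈ Finset.range N,
        q j * (abelAverage a β N (1 - j / N) - abelConst β * (1 - j / N))‖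
        ≤ a N / N * ∑ j ∈ Finset.range N, q j * (ε / (C * 2 + 1)) := by
          refine mul_le_mul_of_nonneg_left ((norm_sum_le _ _).trans ?_) hA
          refine Finset.sum_le_sum fun j hj => ?_
          have hj' : (j : ℝ) ≤ N := by exact_mod_cast (Finset.mem_range.1 hj).le
          have := hN0 N (by omega) (1 - j / N)
            ⟨by rw [sub_nonneg, div_le_one hN']; exact hj',
              by linarith [div_nonneg (Nat.cast_nonneg (α := ℝ) j) hN'.le]⟩
          rw [norm_mul, Real.norm_of_nonneg (hq j)]
          rw [dist_comm, Real.dist_eq] at this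
          exact mul_le_mul_of_nonneg_left this.le (hq j)
      _ = (a N / N * ∑ j ∈ Finset.range N, q j) * (ε / (C * 2 + 1)) := by
          rw [← Finset.sum_mul]; ring
      _ ≤ (C * 2) * (ε / (C * 2 + 1)) := by
          have := hmass N hNpos
          gcongr
      _ < (C * 2 + 1) * (ε / (C * 2 + 1)) := by
          have : 0 < ε / (C * 2 + 1) := by positivity
          nlinarith
      _ = ε := by field_simp
  have h2 := (h1.sub hdiff).div_const (abelConst β)
  simp only [sub_zero, sub_sub_cancel] at h2
  refine h2.congr fun N => ?_
  field_simp

/-- Tauberian theorem: if `(q * a)(n) ∼ n` with `q ≥ 0` and `a` regularly varying with exponent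
`1 - β`, then `∑_{j < n} q j ∼ C n / a n`, where `C > 0` depends on `β` only. The second-order sums
`W` are regularly varying with exponent `1 + β`, and their increments are monotone, so that the
asymptotics of `W` may be differentiated. -/
theorem tendsto_sum_mul_div (hβ : 0 < β) (hβ1 : β ≤ 1) (ha : Monotone a) (ha0 : a 0 = 0)
    (hrv : IsRegularlyVarying a (1 - β)) (hq : ∀ j, 0 ≤ q j)
    (hκ : Tendsto (fun n : ℕ => renewalSum a q n / n) atTop (𝓝 1)) :
    Tendsto (fun n : ℕ => (∑ j ∈ Finset.range n, q j) * (a n / n)) atTop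
      (𝓝 ((1 + β) * tauberConst β)) := by
  set D := tauberConst β with hD
  have hD0 : 0 < D := tauberConst_pos hβ hβ1
  set w : ℕ → ℝ := fun n => ∑ j ∈ Finset.range n, q j with hw
  set W : ℕ → ℝ := fun n => ∑ j ∈ Finset.range n, q j * (n - j) with hW
  have hnn : ∀ m, 0 ≤ a m := fun m => ha0 ▸ ha (Nat.zero_le m)
  have hW1 : Tendsto (fun n : ℕ => W n * (a n / n ^ 2)) atTop (𝓝 D) := by
    refine (tendsto_weighted_sum hβ hβ1 ha ha0 hrv hq hκ).congr' ?_
    filter_upwards [eventually_gt_atTop 0] with n hn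
    have hn' : (0 : ℝ) < n := by exact_mod_cast hn
    simp only [hW, Finset.mul_sum, Finset.sum_mul]
    refine Finset.sum_congr rfl fun j _ => ?_
    field_simp
  -- the increments of `W` are controlled by `w`, from both sides
  have hlow : ∀ {n m : ℕ}, n ≤ m → ((m : ℝ) - n) * w n ≤ W m - W n := by
    intro n m h
    have h1 : ∑ j ∈ Finset.range n, q j * ((m : ℝ) - j) ≤ W m := by
      refine Finset.sum_le_sum_of_subset_of_nonneg (Finset.range_mono h) fun j hj _ => ?_
      have : (j : ℝ) ≤ m := by exact_mod_cast (Finset.mem_range.1 hj).le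
      exact mul_nonneg (hq j) (by linarith)
    have h2 : ∑ j ∈ Finset.range n, q j * ((m : ℝ) - j) = W n + (m - n) * w n := by
      simp only [hW, hw, Finset.mul_sum, ← Finset.sum_add_distrib]
      exact Finset.sum_congr rfl fun j _ => by ring
    linarith
  have hupp : ∀ {n m : ℕ}, n ≤ m → W m - W n ≤ ((m : ℝ) - n) * w m := by
    intro n m h
    have h1 : ∑ j ∈ Finset.range m, q j * ((n : ℝ) - j) ≤ W n := by
      rw [hW, ← Finset.sum_range_add_sum_Ico _ h]
      have : ∑ j ∈ Finset.Ico n m, q j * ((n : ℝ) - j) ≤ 0 := by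
        refine Finset.sum_nonpos fun j hj => ?_
        have : (n : ℝ) ≤ j := by exact_mod_cast (Finset.mem_Ico.1 hj).1
        exact mul_nonpos_of_nonneg_of_nonpos (hq j) (by linarith)
      linarith
    have h2 : ∑ j ∈ Finset.range m, q j * ((n : ℝ) - j) = W m - (m - n) * w m := by
      simp only [hW, hw, Finset.mul_sum, ← Finset.sum_sub_distrib]
      exact Finset.sum_congr rfl fun j _ => by ring
    linarith
  -- regular variation of `W`
  have hWc : ∀ c : ℝ, 0 < c → Tendsto (fun n : ℕ => W ⌊c * n⌋₊ * (a n / n ^ 2)) atTop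
      (𝓝 (D * c ^ (1 + β))) := by
    intro c hc
    have hf : Tendsto (fun N : ℕ => ⌊c * (N : ℝ)⌋₊) atTop atTop :=
      tendsto_nat_floor_atTop.comp (tendsto_natCast_atTop_atTop.const_mul_atTop hc)
    have h2 : Tendsto (fun N : ℕ => (⌊c * (N : ℝ)⌋₊ : ℝ) / N) atTop (𝓝 c) :=
      (tendsto_nat_floor_mul_div_atTop hc.le).comp tendsto_natCast_atTop_atTop
    have h3 := ((hW1.comp hf).mul (h2.pow 2)).div (hrv.2 c hc) (by positivity)
    have e : D * c ^ 2 / c ^ (1 - β) = D * c ^ (1 + β) := by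
      rw [mul_div_assoc, ← Real.rpow_natCast, ← Real.rpow_sub hc]
      congr 2; push_cast; ring
    rw [e] at h3
    refine h3.congr' ?_
    filter_upwards [hf.eventually_gt_atTop 0, eventually_gt_atTop 0, hrv.1, hf.eventually hrv.1]
      with n hn hn0 han hafn
    have h5 : (0 : ℝ) < ⌊c * (n : ℝ)⌋₊ := by exact_mod_cast hn
    have h6 : (0 : ℝ) < n := by exact_mod_cast hn0
    simp only [Function.comp_apply, Pi.div_apply]
    field_simp
  have hslope : HasDerivAt (fun c : ℝ => D * c ^ (1 + β)) (D * (1 + β)) 1 := by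
    have := (Real.hasDerivAt_rpow_const (x := 1) (p := 1 + β) (Or.inl one_ne_zero)).const_mul D
    simpa using this
  have hstep : ∀ c : ℝ, 0 < c → c ≠ 1 → Tendsto (fun n : ℕ => (W ⌊c * n⌋₊ - W n) *
      (a n / n ^ 2) / ((⌊c * n⌋₊ - (n : ℝ)) / n)) atTop
        (𝓝 ((D * c ^ (1 + β) - D) / (c - 1))) := by
    intro c hc h
    have h2 : Tendsto (fun N : ℕ => (⌊c * (N : ℝ)⌋₊ : ℝ) / N) atTop (𝓝 c) :=
      (tendsto_nat_floor_mul_div_atTop hc.le).comp tendsto_natCast_atTop_atTop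
    refine (((hWc c hc).sub hW1).div (h2.sub_const 1) (sub_ne_zero.2 h)).congr' ?_
    filter_upwards [eventually_gt_atTop 0] with n hn
    have h6 : (0 : ℝ) < n := by exact_mod_cast hn
    simp only [Pi.div_apply]
    congr 1
    · ring
    · field_simp
  rw [hasDerivAt_iff_tendsto_slope] at hslope
  have hsl : ∀ c : ℝ, slope (fun c : ℝ => D * c ^ (1 + β)) 1 c = (D * c ^ (1 + β) - D) / (c - 1) := by
    intro c; simp [slope_def_field]
  rw [mul_comm (1 + β)]
  refine tendsto_order.2 ⟨fun y hy => ?_, fun y hy => ?_⟩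
  -- the lower bound compares `n` with `⌊c n⌋` for some `c < 1`, the upper one for some `c > 1`
  · have h1 : ∀ᶠ c in 𝓝[<] (1 : ℝ), y < slope (fun c : ℝ => D * c ^ (1 + β)) 1 c :=
      (hslope.mono_left (nhdsWithin_mono _ fun c hc => ne_of_lt hc)).eventually_const_lt hy
    have h2 : ∀ᶠ c in 𝓝[<] (1 : ℝ), 0 < c :=
      (tendsto_id.mono_left nhdsWithin_le_nhds).eventually_const_lt zero_lt_one
    obtain ⟨c, ⟨hc1, hc2⟩, hc3⟩ := ((h1.and h2).and self_mem_nhdsWithin).exists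
    rw [hsl] at hc1
    have hc3 : c < 1 := hc3
    have := (hstep c hc2 hc3.ne).eventually_const_lt hc1
    filter_upwards [this, eventually_gt_atTop 0] with n hn hn0
    have h6 : (0 : ℝ) < n := by exact_mod_cast hn0
    have hfl : (⌊c * n⌋₊ : ℝ) < n :=
      (Nat.floor_le (by positivity)).trans_lt (by nlinarith)
    have hfl' : ⌊c * n⌋₊ ≤ n := by exact_mod_cast hfl.le
    refine hn.trans_le ?_
    rw [div_le_iff_of_neg (div_neg_of_neg_of_pos (by linarith) h6)]
    have h7 := mul_le_mul_of_nonneg_right (hupp hfl') (div_nonneg (hnn n) (sq_nonneg (n : ℝ)))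
    have e : w n * (a n / n) * ((⌊c * n⌋₊ - (n : ℝ)) / n) =
      -(((n : ℝ) - ⌊c * n⌋₊) * w n * (a n / n ^ 2)) := by ring
    change w n * (a n / n) * ((⌊c * n⌋₊ - (n : ℝ)) / n) ≤ _
    rw [e]; linarith
  · have h1 : ∀ᶠ c in 𝓝[>] (1 : ℝ), slope (fun c : ℝ => D * c ^ (1 + β)) 1 c < y :=
      (hslope.mono_left (nhdsWithin_mono _ fun c hc => ne_of_gt hc)).eventually_lt_const hy
    obtain ⟨c, hc1, hc3⟩ := (h1.and self_mem_nhdsWithin).exists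
    rw [hsl] at hc1
    have hc3 : 1 < c := hc3
    have hc2 : 0 < c := by linarith
    have := (hstep c hc2 hc3.ne').eventually_lt_const hc1
    have h2 : Tendsto (fun N : ℕ => (⌊c * (N : ℝ)⌋₊ : ℝ) / N) atTop (𝓝 c) :=
      (tendsto_nat_floor_mul_div_atTop hc2.le).comp tendsto_natCast_atTop_atTop
    filter_upwards [this, eventually_gt_atTop 0, h2.eventually_const_lt hc3] with n hn hn0 hfl
    have h6 : (0 : ℝ) < n := by exact_mod_cast hn0
    rw [lt_div_iff₀ h6, one_mul] at hfl
    have hfl' : n ≤ ⌊c * n⌋₊ := by exact_mod_cast hfl.le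
    refine lt_of_le_of_lt ?_ hn
    rw [le_div_iff₀ (div_pos (by linarith) h6)]
    have h7 := mul_le_mul_of_nonneg_right (hlow hfl') (div_nonneg (hnn n) (sq_nonneg (n : ℝ)))
    have e : w n * (a n / n) * ((⌊c * n⌋₊ - (n : ℝ)) / n) =
      ((⌊c * n⌋₊ : ℝ) - n) * w n * (a n / n ^ 2) := by ring
    change w n * (a n / n) * ((⌊c * n⌋₊ - (n : ℝ)) / n) ≤ _
    rw [e]; linarith

end

/-! ### The `M₁` distance between monotone paths -/

namespace SkorohodD

variable {x y : SkorohodD}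

theorem left_zero (x : SkorohodD) : x.left 0 = x.toFun 0 :=
  leftLim_eq_of_isBot fun t => t.2.1

theorem mem_completedGraph_iff (hx : Monotone x.toFun) {p : ℝ × I} :
    p ∈ x.completedGraph ↔ x.left p.2 ≤ p.1 ∧ p.1 ≤ x.toFun p.2 := by
  have h : x.left p.2 ≤ x.toFun p.2 := hx.leftLim_le le_rfl
  rw [completedGraph, mem_ofPred_eq, segment_eq_Icc h, mem_Icc]

/-- The completed graph of a monotone path is a chain. -/
theorem completedGraph_chain (hx : Monotone x.toFun) {p q : ℝ × I} (hp : p ∈ x.completedGraph)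
    (hq : q ∈ x.completedGraph) : p ≤ q ∨ q ≤ p := by
  rw [mem_completedGraph_iff hx] at hp hq
  rcases lt_trichotomy p.2 q.2 with h | h | h
  · exact Or.inl ⟨hp.2.trans ((hx.le_leftLim h).trans hq.1), h.le⟩
  · rcases le_total p.1 q.1 with h' | h'
    · exact Or.inl ⟨h', h.le⟩
    · exact Or.inr ⟨h', h.ge⟩
  · exact Or.inr ⟨hq.2.trans ((hx.le_leftLim h).trans hp.1), h.le⟩

/-- The antidiagonal coordinate `z + t` of a point `(z, t)`. It parametrizes the completed graph of
a monotone path. -/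
def level (p : ℝ × I) : ℝ := p.1 + p.2

theorem dist_le_of_le {p q : ℝ × I} (h : p ≤ q) : dist p q ≤ level q - level p := by
  have h1 : p.1 ≤ q.1 := h.1
  have h2 : (p.2 : ℝ) ≤ q.2 := h.2
  rw [Prod.dist_eq, Subtype.dist_eq, Real.dist_eq, Real.dist_eq, abs_of_nonpos (by linarith),
    abs_of_nonpos (by linarith), max_le_iff]
  simp only [level]
  constructor <;> linarith

/-- On the completed graph of a monotone path, the inverse of `level` is `1`-Lipschitz. -/
theorem dist_le_level (hx : Monotone x.toFun) {p q : ℝ × I} (hp : p ∈ x.completedGraph)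
    (hq : q ∈ x.completedGraph) : dist p q ≤ |level p - level q| := by
  rcases completedGraph_chain hx hp hq with h | h
  · exact (dist_le_of_le h).trans (by rw [abs_sub_comm]; exact le_abs_self _)
  · rw [dist_comm]; exact (dist_le_of_le h).trans (le_abs_self _)

theorem abs_level_sub_le (p q : ℝ × I) : |level p - level q| ≤ 2 * dist p q := by
  have h1 : |p.1 - q.1| ≤ dist p q := by
    rw [Prod.dist_eq, ← Real.dist_eq]; exact le_max_left _ _
  have h2 : |(p.2 : ℝ) - q.2| ≤ dist p q := by
    rw [Prod.dist_eq, ← Real.dist_eq, ← Subtype.dist_eq]; exact le_max_right _ _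
  have e : level p - level q = (p.1 - q.1) + (p.2 - q.2) := by simp only [level]; ring
  rw [e]
  exact (abs_add_le _ _).trans (by linarith)

/-- Every antidiagonal between the endpoints meets the completed graph, at the first time `t` where
`x t + t` reaches the given level. -/
theorem exists_level_eq (hx : Monotone x.toFun) {s : ℝ} (h0 : x.toFun 0 ≤ s)
    (h1 : s ≤ x.toFun 1 + 1) : ∃ p ∈ x.completedGraph, level p = s := by
  set S : Set I := {t | s ≤ x.toFun t + t} with hS
  have hSne : (1 : I) ∈ S := by simpa [hS] using h1
  set t := sInf S with ht
  have hlow : ∀ t' < t, x.toFun t' + t' < s := fun t' h => by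
    have : t' ∉ S := notMem_of_lt_csInf h (OrderBot.bddBelow S)
    simpa [hS] using this
  have hup : s ≤ x.toFun t + t := by
    by_contra! hcon
    have hc : ContinuousWithinAt (fun u : I => x.toFun u + u) (Ici t) t :=
      (x.rightCont t).add continuous_subtype_val.continuousWithinAt
    have hev : ∀ᶠ u in 𝓝[≥] t, x.toFun u + u < s := hc.eventually_lt_const hcon
    have ht1 : t < 1 := by
      refine lt_of_le_of_ne (sInf_le hSne) fun h => ?_
      rw [h] at hcon; exact absurd (show s ≤ x.toFun 1 + ((1 : I) : ℝ) from hSne) (not_le.2 hcon)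
    obtain ⟨b, hb, hb'⟩ := (mem_nhdsGE_iff_exists_Ico_subset' ht1).1 hev
    have : b ≤ t := le_csInf ⟨_, hSne⟩ fun u hu => by
      by_contra! hub
      have htu : t ≤ u := sInf_le hu
      exact absurd (show s ≤ x.toFun u + u from hu) (not_le.2 (hb' ⟨htu, hub⟩))
    exact absurd hb (not_lt.2 this)
  have hl : x.left t + t ≤ s := by
    rcases eq_or_ne t 0 with h | h
    · rw [h, left_zero]; simpa using h0
    have ht0 : 0 < t := lt_of_le_of_ne t.2.1 (Ne.symm h)
    have hne : (𝓝[<] t).NeBot := nhdsLT_neBot_of_exists_lt ⟨0, ht0⟩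
    have hlim : Tendsto (fun u : I => x.toFun u + u) (𝓝[<] t) (𝓝 (x.left t + t)) :=
      (hx.tendsto_leftLim t).add continuous_subtype_val.continuousWithinAt
    refine le_of_tendsto hlim ?_
    filter_upwards [self_mem_nhdsWithin] with u hu using (hlow u hu).le
  refine ⟨(s - t, t), (mem_completedGraph_iff hx).2 ⟨?_, ?_⟩, by simp [level]⟩ <;>
    dsimp only <;> linarith

theorem level_mem (hx : Monotone x.toFun) {p : ℝ × I} (hp : p ∈ x.completedGraph) :
    x.toFun 0 ≤ level p ∧ level p ≤ x.toFun 1 + 1 := by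
  rw [mem_completedGraph_iff hx] at hp
  have h1 : x.left 0 ≤ x.left p.2 := hx.leftLim p.2.2.1
  rw [left_zero] at h1
  have h2 : x.toFun p.2 ≤ x.toFun 1 := hx p.2.2.2
  have h3 := p.2.2.1
  have h4 := p.2.2.2
  simp only [level]
  constructor <;> linarith [hp.1, hp.2]

/-- A monotone path has a parametric representation that is affine in the antidiagonal
coordinate. -/
theorem exists_parametricRep (hx : Monotone x.toFun) : ∃ γ ∈ x.parametricRep,
    ∀ s : I, level (γ s) = x.toFun 0 + s * (x.toFun 1 + 1 - x.toFun 0) := by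
  set L := x.toFun 1 + 1 - x.toFun 0 with hL
  have hL0 : 0 < L := by
    have : x.toFun 0 ≤ x.toFun 1 := hx zero_le_one
    linarith
  have hex : ∀ s : I, ∃ p ∈ x.completedGraph, level p = x.toFun 0 + s * L := fun s => by
    refine exists_level_eq hx ?_ ?_
    · have := mul_nonneg s.2.1 hL0.le
      linarith
    · have := mul_le_of_le_one_left hL0.le s.2.2
      linarith
  choose g hg hgl using hex
  have hlip : LipschitzWith ⟨L, hL0.le⟩ g := LipschitzWith.of_dist_le_mul fun s s' => by
    refine (dist_le_level hx (hg s) (hg s')).trans ?_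
    rw [hgl, hgl, Subtype.dist_eq, Real.dist_eq, add_sub_add_left_eq_sub, ← sub_mul, abs_mul,
      abs_of_pos hL0, mul_comm]
    rfl
  have hmono : Monotone g := fun s s' h => by
    have hle : level (g s) ≤ level (g s') := by
      rw [hgl, hgl]
      have : (s : ℝ) ≤ s' := h
      gcongr
    rcases completedGraph_chain hx (hg s) (hg s') with h' | h'
    · exact h'
    · have := dist_le_of_le h'
      have : dist (g s') (g s) ≤ 0 := this.trans (by linarith)
      exact (dist_le_zero.1 this).ge
  refine ⟨⟨g, hlip.continuous⟩, ⟨?_, ?_⟩, hgl⟩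
  · refine Subset.antisymm (by rintro _ ⟨s, rfl⟩; exact hg s) fun p hp => ?_
    obtain ⟨h0, h1⟩ := level_mem hx hp
    refine ⟨⟨(level p - x.toFun 0) / L, div_nonneg (by linarith) hL0.le,
      (div_le_one hL0).2 (by linarith)⟩, ?_⟩
    refine dist_le_zero.1 ((dist_le_level hx (hg _) hp).trans ?_)
    rw [hgl]
    simp only
    rw [div_mul_cancel₀ _ hL0.ne']
    simp
  · intro s s' h
    have hm := hmono h
    rcases (show (g s).2 ≤ (g s').2 from hm.2).lt_or_eq with h' | h'
    · exact Or.inl h'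
    · refine Or.inr ⟨h', ?_⟩
      have h1 := ((mem_completedGraph_iff hx).1 (hg s)).1
      have h2 : (g s).1 ≤ (g s').1 := hm.1
      change |x.left (g s).2 - (g s).1| ≤ |x.left (g s).2 - (g s').1|
      rw [abs_of_nonpos (by linarith), abs_of_nonpos (by linarith)]
      linarith

/-- Two monotone paths that start at `0` are `M₁`-close if they have close final values and one
completed graph lies in a neighbourhood of the other one: the representations that are affine in
the antidiagonal coordinate are then close. -/
theorem m1Dist_le (hx : Monotone x.toFun) (hy : Monotone y.toFun) (hx0 : x.toFun 0 = 0)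
    (hy0 : y.toFun 0 = 0) {δ : ℝ} (h1 : |x.toFun 1 - y.toFun 1| ≤ δ)
    (hΓ : ∀ q ∈ y.completedGraph, ∃ p ∈ x.completedGraph, dist p q ≤ δ) :
    m1Dist x y ≤ ENNReal.ofReal (4 * δ) := by
  obtain ⟨γ, hγ, hγl⟩ := exists_parametricRep hx
  obtain ⟨η, hη, hηl⟩ := exists_parametricRep hy
  have hδ : 0 ≤ δ := (abs_nonneg _).trans h1
  refine (iInf₂_le γ hγ).trans ((iInf₂_le η hη).trans ?_)
  rw [edist_dist]
  refine ENNReal.ofReal_le_ofReal ((ContinuousMap.dist_le (by positivity)).2 fun s => ?_)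
  have hγs : γ s ∈ x.completedGraph := hγ.1 ▸ mem_range_self s
  have hηs : η s ∈ y.completedGraph := hη.1 ▸ mem_range_self s
  obtain ⟨p, hp, hpd⟩ := hΓ _ hηs
  have e1 : |level (γ s) - level (η s)| ≤ δ := by
    rw [hγl, hηl, hx0, hy0]
    have : 0 + (s : ℝ) * (x.toFun 1 + 1 - 0) - (0 + s * (y.toFun 1 + 1 - 0)) =
      s * (x.toFun 1 - y.toFun 1) := by ring
    rw [this, abs_mul, abs_of_nonneg s.2.1]
    exact (mul_le_of_le_one_left (abs_nonneg _) s.2.2).trans h1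
  have e2 := abs_level_sub_le p (η s)
  have e3 := dist_le_level hx hγs hp
  have e4 : |level (γ s) - level p| ≤ |level (γ s) - level (η s)| + |level p - level (η s)| := by
    rw [abs_sub_comm (level p)]; exact abs_sub_le _ _ _
  have e5 := dist_triangle (γ s) p (η s)
  linarith

theorem m1Dist_le_of_uniform (hx : Monotone x.toFun) (hy : Monotone y.toFun) (hx0 : x.toFun 0 = 0)
    (hy0 : y.toFun 0 = 0) {δ : ℝ} (h : ∀ t, |x.toFun t - y.toFun t| ≤ δ) :
    m1Dist x y ≤ ENNReal.ofReal (4 * δ) := by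
  refine m1Dist_le hx hy hx0 hy0 (h 1) fun q hq => ?_
  have hδ : 0 ≤ δ := (abs_nonneg _).trans (h 1)
  have hl : |x.left q.2 - y.left q.2| ≤ δ := by
    rcases (𝓝[<] q.2).eq_or_neBot with hb | hb
    · rw [left, left, leftLim_eq_of_eq_bot _ hb, leftLim_eq_of_eq_bot _ hb]
      exact h _
    · exact le_of_tendsto (((hx.tendsto_leftLim q.2).sub (hy.tendsto_leftLim q.2)).abs)
        (Eventually.of_forall h)
  rw [mem_completedGraph_iff hy] at hq
  have hm : x.left q.2 ≤ x.toFun q.2 := hx.leftLim_le le_rfl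
  refine ⟨(max (x.left q.2) (min q.1 (x.toFun q.2)), q.2), (mem_completedGraph_iff hx).2
    ⟨le_max_left _ _, max_le hm (min_le_right _ _)⟩, ?_⟩
  have h1 := abs_le.1 (h q.2)
  have h2 := abs_le.1 hl
  rw [Prod.dist_eq, dist_self, max_le_iff, Real.dist_eq, abs_le]
  refine ⟨⟨?_, ?_⟩, hδ⟩ <;> dsimp only
  · have : q.1 - δ ≤ min q.1 (x.toFun q.2) := le_min (by linarith) (by linarith [hq.2])
    linarith [le_max_right (x.left q.2) (min q.1 (x.toFun q.2))]
  · have : max (x.left q.2) (min q.1 (x.toFun q.2)) ≤ q.1 + δ :=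
      max_le (by linarith [hq.1]) ((min_le_left _ _).trans (by linarith))
    linarith

/-- The monotone path `x` is `δ`-close to the step from `0` to `c` at time `v`: it vanishes before
`v - δ`, is within `δ` of `c` after `v + δ` and at time `1` (which may be before `v + δ`), and takes
its values in `[0, c]`. -/
structure NearStep (c v δ : ℝ) (x : SkorohodD) : Prop where
  mono : Monotone x.toFun
  zero : x.toFun 0 = 0
  le : ∀ t, x.toFun t ≤ c
  before : ∀ t : I, (t : ℝ) ≤ v - δ → x.toFun t = 0
  after : ∀ t : I, v + δ ≤ t → c - δ ≤ x.toFun t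
  one : c - δ ≤ x.toFun 1

theorem stepPath_apply (c v : ℝ) (t : I) :
    (stepPath c v).toFun t = if v ≤ (t : ℝ) then c else 0 := by
  simp [stepPath]

theorem stepPath_mono {c v : ℝ} (hc : 0 ≤ c) : Monotone (stepPath c v).toFun := fun t t' h => by
  have h' : (t : ℝ) ≤ t' := h
  rw [stepPath_apply, stepPath_apply]
  split_ifs with h1 h2 h2
  · exact le_rfl
  · exact absurd (h1.trans h') h2
  · exact hc
  · exact le_rfl

/-- A path close to a step in the sense of `NearStep` is `M₁`-close to it. The vertical segment of
the completed graph of the step absorbs the values taken between `v - δ` and `v + δ`. -/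
theorem NearStep.m1Dist_le {c v δ : ℝ} (hc : 0 ≤ c) (hv : v ∈ Ioc (0 : ℝ) 1) (hδ : 0 < δ)
    (h : NearStep c v δ x) : m1Dist (stepPath c v) x ≤ ENNReal.ofReal (4 * (2 * δ)) := by
  have hs := stepPath_mono (v := v) hc
  have hnn : ∀ t, 0 ≤ x.toFun t := fun t => h.zero ▸ h.mono t.2.1
  refine SkorohodD.m1Dist_le hs h.mono (by simp [stepPath_apply, hv.1]) h.zero ?_ fun q hq => ?_
  · have h1 := h.one
    have h2 := h.le 1
    simp only [stepPath_apply, Icc.coe_one, hv.2, if_true]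
    rw [abs_le]; constructor <;> linarith
  rw [mem_completedGraph_iff h.mono] at hq
  have hq1 : q.1 ≤ c := hq.2.trans (h.le _)
  have hq0 : 0 ≤ q.1 := by
    refine le_trans ?_ hq.1
    have : x.left 0 ≤ x.left q.2 := h.mono.leftLim q.2.2.1
    rwa [left_zero, h.zero] at this
  have hdist : ∀ (z : ℝ) (t : I), |z - q.1| ≤ 2 * δ → |(t : ℝ) - q.2| ≤ 2 * δ →
      dist (z, t) q ≤ 2 * δ := fun z t h1 h2 => by
    rw [Prod.dist_eq, Subtype.dist_eq, Real.dist_eq, Real.dist_eq]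
    exact max_le h1 h2
  rcases lt_or_ge (q.2 : ℝ) (v - δ) with hlt | hge
  · refine ⟨(0, q.2), (mem_completedGraph_iff hs).2 ?_, hdist _ _ ?_ (by simp; positivity)⟩
    · have e : (stepPath c v).toFun q.2 = 0 := by
        rw [stepPath_apply, if_neg]; linarith
      refine ⟨?_, e.ge⟩
      rw [← e]; exact hs.leftLim_le le_rfl
    · have : q.1 ≤ 0 := by rw [← h.before q.2 hlt.le]; exact hq.2
      rw [abs_le]; constructor <;> linarith
  rcases le_or_gt (q.2 : ℝ) (v + δ) with hle | hgt
  · refine ⟨(q.1, ⟨v, hv.1.le, hv.2⟩), (mem_completedGraph_iff hs).2 ⟨?_, ?_⟩,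
      hdist _ _ (by simp; positivity) ?_⟩
    · refine le_trans ?_ hq0
      have hlim := hs.tendsto_leftLim ⟨v, hv.1.le, hv.2⟩
      have hne : (𝓝[<] (⟨v, hv.1.le, hv.2⟩ : I)).NeBot :=
        nhdsLT_neBot_of_exists_lt ⟨0, show (0 : ℝ) < v from hv.1⟩
      refine le_of_tendsto hlim ?_
      filter_upwards [self_mem_nhdsWithin] with t ht
      have ht : (t : ℝ) < v := ht
      rw [stepPath_apply, if_neg (not_le.2 ht)]
    · dsimp only
      rw [stepPath_apply, if_pos le_rfl]; exact hq1
    · dsimp only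
      rw [abs_le]; constructor <;> linarith
  · have hv1 : v + δ / 2 < q.2 := by linarith
    set t' : I := ⟨v + δ, by linarith [hv.1], hgt.le.trans q.2.2.2⟩ with ht'
    have ht'q : t' < q.2 := hgt
    refine ⟨(c, q.2), (mem_completedGraph_iff hs).2 ⟨?_, ?_⟩, hdist _ _ ?_ (by simp; positivity)⟩
    · refine (hs.leftLim_le le_rfl).trans ?_
      rw [stepPath_apply, if_pos (by linarith)]
    · dsimp only
      rw [stepPath_apply, if_pos (by linarith)]
    · have h1 : c - δ ≤ x.toFun t' := h.after t' le_rfl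
      have h2 : x.toFun t' ≤ x.left q.2 := h.mono.le_leftLim ht'q
      rw [abs_le]; constructor <;> linarith [hq.1]

theorem nearStep_stepPath {c v w δ : ℝ} (hc : 0 ≤ c) (hw : w ∈ Ioc (0 : ℝ) 1) (h : |w - v| < δ) :
    NearStep c v δ (stepPath c w) where
  mono := stepPath_mono hc
  zero := by simp [stepPath_apply, hw.1]
  le t := by rw [stepPath_apply]; split_ifs <;> simp [hc]
  before t ht := by rw [stepPath_apply, if_neg]; linarith [(abs_lt.1 h).1]
  after t ht := by
    rw [stepPath_apply, if_pos (by linarith [(abs_lt.1 h).2])]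
    linarith [(abs_nonneg _).trans_lt h]
  one := by
    rw [stepPath_apply, if_pos (by simpa using hw.2)]
    linarith [(abs_nonneg _).trans_lt h]

end SkorohodD

/-! ### Entrance times -/

section
variable {E : Type*} {T : E → E} {A : Set E}

/-- The set `{φ_A ≤ n}` of points whose orbit visits `A` at one of the times `1, …, n`. -/
def entranceSet (T : E → E) (A : Set E) (n : ℕ) : Set E := {x | ∃ k, 1 ≤ k ∧ k ≤ n ∧ T^[k] x ∈ A}

theorem firstEntrance_le_iff {n : ℕ} {x : E} :
    firstEntrance T A x ≤ (n : ℕ∞) ↔ x ∈ entranceSet T A n := by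
  constructor
  · intro h
    by_contra hx
    have : ((n + 1 : ℕ) : ℕ∞) ≤ firstEntrance T A x := by
      refine le_sInf ?_
      rintro _ ⟨k, ⟨hk1, hk2⟩, rfl⟩
      by_contra! hlt
      have hlt : k < n + 1 := by exact_mod_cast hlt
      exact hx ⟨k, hk1, by omega, hk2⟩
    have : n + 1 ≤ n := by exact_mod_cast this.trans h
    omega
  · rintro ⟨k, hk1, hk2, hk3⟩
    have : firstEntrance T A x ≤ (k : ℕ∞) := sInf_le ⟨k, ⟨hk1, hk3⟩, rfl⟩
    exact this.trans (by exact_mod_cast hk2)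

theorem entranceSet_zero : entranceSet T A 0 = ∅ := by
  ext x
  simp only [entranceSet, mem_ofPred_eq, mem_empty_iff_false, iff_false]
  rintro ⟨k, h1, h2, -⟩
  omega

theorem entranceSet_succ (n : ℕ) : entranceSet T A (n + 1) = T ⁻¹' (A ∪ entranceSet T A n) := by
  ext x
  simp only [entranceSet, mem_ofPred_eq, mem_preimage, mem_union]
  constructor
  · rintro ⟨k, h1, h2, h3⟩
    obtain ⟨k, rfl⟩ := Nat.exists_eq_add_of_le' h1
    rw [Function.iterate_succ_apply] at h3
    rcases k.eq_zero_or_pos with rfl | hk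
    · exact Or.inl h3
    · exact Or.inr ⟨k, hk, by omega, h3⟩
  · rintro (h | ⟨k, h1, h2, h3⟩)
    · exact ⟨1, le_rfl, by omega, h⟩
    · exact ⟨k + 1, by omega, by omega, by rwa [Function.iterate_succ_apply]⟩

theorem entranceSet_mono : Monotone (entranceSet T A) := fun _ _ h _ ⟨k, h1, h2, h3⟩ =>
  ⟨k, h1, h2.trans h, h3⟩

theorem entranceSet_subset {B : Set E} (h : B ⊆ A) (n : ℕ) :
    entranceSet T B n ⊆ entranceSet T A n := fun _ ⟨k, h1, h2, h3⟩ => ⟨k, h1, h2, h h3⟩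

variable [MeasurableSpace E] {μ : Measure E} {g : E → ℝ}

theorem measurableSet_entranceSet (hT : Measurable T) (hA : MeasurableSet A) (n : ℕ) :
    MeasurableSet (entranceSet T A n) := by
  induction n with
  | zero => rw [entranceSet_zero]; exact .empty
  | succ n ih => rw [entranceSet_succ]; exact hT (hA.union ih)

theorem measure_entranceSet_succ (hT : MeasurePreserving T μ μ) (hA : MeasurableSet A) (n : ℕ) :
    μ (entranceSet T A (n + 1)) = μ (entranceSet T A n) + μ (A \ entranceSet T A n) := by
  have hm := measurableSet_entranceSet hT.measurable hA n
  rw [entranceSet_succ, hT.measure_preimage (hA.union hm).nullMeasurableSet,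
    union_comm, ← union_sdiff_self, measure_union disjoint_sdiff_right (hA.diff hm)]

theorem measure_entranceSet_lt_top (hT : MeasurePreserving T μ μ) (hA : MeasurableSet A)
    (hA' : μ A < ∞) (n : ℕ) : μ (entranceSet T A n) < ∞ := by
  induction n with
  | zero => simp [entranceSet_zero]
  | succ n ih =>
    rw [measure_entranceSet_succ hT hA]
    exact ENNReal.add_lt_top.2 ⟨ih, (measure_mono sdiff_subset).trans_lt hA'⟩

/-- The wandering rate `μ(φ_A ≤ n)` is the sum of the tails `μ(A ∩ {φ_A > j})`, `j < n`. -/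
theorem measureReal_entranceSet (hT : MeasurePreserving T μ μ) (hA : MeasurableSet A)
    (hA' : μ A < ∞) (n : ℕ) :
    ∑ j ∈ Finset.range n, μ.real (A \ entranceSet T A j) = μ.real (entranceSet T A n) := by
  induction n with
  | zero => simp [entranceSet_zero]
  | succ n ih =>
    rw [Finset.sum_range_succ, ih, measureReal_def, measureReal_def, measureReal_def,
      measure_entranceSet_succ hT hA, ENNReal.toReal_add (measure_entranceSet_lt_top hT hA hA' n).ne
        ((measure_mono sdiff_subset).trans_lt hA').ne]

theorem measure_entranceSet_pos (hT : MeasurePreserving T μ μ) (hA : MeasurableSet A)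
    (hA' : 0 < μ A) (n : ℕ) : 0 < μ (entranceSet T A (n + 1)) := by
  refine hA'.trans_le ?_
  rw [entranceSet_succ, hT.measure_preimage
    (hA.union (measurableSet_entranceSet hT.measurable hA n)).nullMeasurableSet]
  exact measure_mono subset_union_left

/-- Under a conservative ergodic map, almost every orbit visits a given set of positive measure. -/
theorem ae_exists_iterate_mem (hc : Conservative T μ) (he : Ergodic T μ) (hA : MeasurableSet A)
    (hA' : 0 < μ A) : ∀ᵐ x ∂μ, x ∈ ⋃ n, entranceSet T A (n + 1) := by
  set S : Set E := {x | ∃ᶠ n in atTop, T^[n] x ∈ A} with hS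
  have hSm : MeasurableSet S := by
    have : S = ⋂ N : ℕ, ⋃ n : ℕ, ⋃ _ : n ≥ N, T^[n] ⁻¹' A := by
      ext x; simp [hS, frequently_atTop]
    rw [this]
    exact .iInter fun N => .iUnion fun n => .iUnion fun _ => (he.measurable.iterate n) hA
  have hSinv : T ⁻¹' S = S := by
    ext x
    simp only [hS, mem_preimage, mem_ofPred_eq, ← Function.iterate_succ_apply]
    have h := Filter.frequently_map (f := atTop) (m := (· + 1)) (P := fun n : ℕ => T^[n] x ∈ A)
    rw [map_add_atTop_eq_nat] at h
    exact h.symm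
  rcases he.toPreErgodic.ae_mem_or_ae_notMem hSm hSinv with h | h
  · filter_upwards [h] with x hx
    obtain ⟨n, hn, hnA⟩ := (frequently_atTop.1 hx) 1
    exact mem_iUnion.2 ⟨n, n, hn, by omega, hnA⟩
  · exfalso
    have h2 := hc.ae_mem_imp_frequently_image_mem hA.nullMeasurableSet
    have : ∀ᵐ x ∂μ, x ∉ A := by
      filter_upwards [h, h2] with x h3 h4 h5 using h3 (h4 h5)
    exact hA'.ne' (by simpa [ae_iff] using this)

/-! ### The dual operator and the renewal inequality -/

/-- The sums `∑_{k=1}^n T̂ᵏ g`. -/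
noncomputable def dualSum (T : E → E) (μ : Measure E) (g : E → ℝ) (n : ℕ) (x : E) : ℝ :=
  ∑ k ∈ Finset.range n, (dualOp T μ)^[k + 1] g x

theorem dualAverage_eq (a : ℕ → ℝ) (n : ℕ) (x : E) :
    dualAverage T μ a g n x = dualSum T μ g n x / a n := by
  rw [dualAverage, dualSum, one_div, inv_mul_eq_div]
  congr 1
  have h : Finset.Icc 1 n = Finset.Ico 1 (n + 1) := by ext; simp
  rw [h, Finset.sum_Ico_eq_sum_range]
  simp [add_comm 1]

theorem integrable_dualOp (g : E → ℝ) : Integrable (dualOp T μ g) μ :=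
  SignedMeasure.integrable_rnDeriv _ _

theorem integrable_dualOp_iterate (hg : Integrable g μ) (k : ℕ) :
    Integrable ((dualOp T μ)^[k] g) μ := by
  cases k with
  | zero => exact hg
  | succ k => rw [Function.iterate_succ_apply']; exact integrable_dualOp _

/-- The normalizing sequence of a uniform set may be replaced by that of the pointwise dual ergodic
map: comparing both convergences at a single point shows that they are equivalent. -/
theorem tendstoUniformlyOn_dualAverage_of_tendsto {a a' : ℕ → ℝ} {Z : Set E} (hA : 0 < μ A)
    (hZ : μ Z = 0) (hg0 : 0 < ∫ x, g x ∂μ) (hapos : ∀ᶠ n in atTop, 0 < a n)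
    (hapos' : ∀ᶠ n in atTop, 0 < a' n)
    (hpt : ∀ᵐ x ∂μ, Tendsto (fun n => dualAverage T μ a g n x) atTop (𝓝 (∫ y, g y ∂μ)))
    (hunif : TendstoUniformlyOn (dualAverage T μ a' g) (fun _ => ∫ y, g y ∂μ) atTop (A \ Z)) :
    TendstoUniformlyOn (dualAverage T μ a g) (fun _ => ∫ y, g y ∂μ) atTop (A \ Z) := by
  set G := ∫ x, g x ∂μ with hG
  obtain ⟨x, hxA, hx⟩ : ∃ x ∈ A \ Z, Tendsto (fun n => dualAverage T μ a g n x) atTop (𝓝 G) := by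
    by_contra! hcon
    have : μ (A \ Z) = 0 := by
      refine measure_mono_null (fun x hx => ?_) (ae_iff.1 hpt)
      exact hcon x hx
    rw [measure_sdiff_null hZ] at this
    exact hA.ne' this
  have hx' := hunif.tendsto_at hxA
  have hratio : Tendsto (fun n => a' n / a n) atTop (𝓝 1) := by
    have h := hx.div hx' hg0.ne'
    rw [div_self hg0.ne'] at h
    refine h.congr' ?_
    filter_upwards [hapos, hapos', hx'.eventually_const_lt hg0] with n h1 h2 h3
    rw [dualAverage_eq] at h3
    have h4 : dualSum T μ g n x ≠ 0 := fun h => by simp [h] at h3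
    simp only [Pi.div_apply, dualAverage_eq]
    field_simp
  rw [Metric.tendstoUniformlyOn_iff] at hunif ⊢
  intro ε hε
  have h1 := Metric.tendsto_nhds.1 hratio (min 1 (ε / (2 * G))) (by positivity)
  filter_upwards [hunif (ε / 4) (by positivity), h1, hapos, hapos'] with n h2 h3 h4 h5 y hy
  have h6 := h2 y hy
  rw [Real.dist_eq] at h3
  rw [dist_comm, Real.dist_eq] at h6 ⊢
  have e : dualAverage T μ a g n y = a' n / a n * dualAverage T μ a' g n y := by
    rw [dualAverage_eq, dualAverage_eq]; field_simp
  have h7 : |a' n / a n| ≤ 2 := by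
    have := (abs_lt.1 (h3.trans_le (min_le_left _ _)))
    rw [abs_le]; constructor <;> linarith
  have h8 : |a' n / a n - 1| * G ≤ ε / 2 := by
    have := h3.le.trans (min_le_right _ _)
    rw [le_div_iff₀ (by positivity)] at this
    linarith
  have e2 : dualAverage T μ a g n y - G = a' n / a n * (dualAverage T μ a' g n y - G) +
      (a' n / a n - 1) * G := by rw [e]; ring
  rw [e2]
  refine (abs_add_le _ _).trans_lt ?_
  rw [abs_mul, abs_mul, abs_of_pos hg0]
  have : |a' n / a n| * |dualAverage T μ a' g n y - G| ≤ 2 * |dualAverage T μ a' g n y - G| := by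
    gcongr
  linarith

variable [SigmaFinite μ]

theorem setIntegral_dualOp (hT : MeasurePreserving T μ μ) (hg : Integrable g μ) {B : Set E}
    (hB : MeasurableSet B) : ∫ x in B, dualOp T μ g x ∂μ = ∫ x in T ⁻¹' B, g x ∂μ := by
  have hac : VectorMeasure.map (μ.withDensityᵥ g) T ≪ᵥ μ.toENNRealVectorMeasure := by
    refine VectorMeasure.AbsolutelyContinuous.mk fun S hS h => ?_
    rw [Measure.toENNRealVectorMeasure_apply_measurable hS] at h
    rw [VectorMeasure.map_apply _ hT.measurable hS,
      withDensityᵥ_apply hg (hT.measurable hS)]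
    refine setIntegral_measure_zero _ ?_
    rw [hT.measure_preimage hS.nullMeasurableSet, h]
  have h := SignedMeasure.withDensityᵥ_rnDeriv_eq _ μ hac
  have h2 := DFunLike.congr_fun h B
  change (μ.withDensityᵥ (dualOp T μ g)) B = _ at h2
  rw [withDensityᵥ_apply (integrable_dualOp g) hB, VectorMeasure.map_apply _ hT.measurable hB,
      withDensityᵥ_apply hg (hT.measurable hB)] at h2
  exact h2

theorem dualOp_nonneg (hT : MeasurePreserving T μ μ) (hg : Integrable g μ) (h0 : 0 ≤ᵐ[μ] g) :
    0 ≤ᵐ[μ] dualOp T μ g := by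
  refine ae_nonneg_of_forall_setIntegral_nonneg (integrable_dualOp g) fun s hs _ => ?_
  rw [setIntegral_dualOp hT hg hs]
  exact integral_nonneg_of_ae (ae_restrict_of_ae h0)

theorem dualOp_iterate_nonneg (hT : MeasurePreserving T μ μ) (hg : Integrable g μ)
    (h0 : 0 ≤ᵐ[μ] g) (k : ℕ) : 0 ≤ᵐ[μ] (dualOp T μ)^[k] g := by
  induction k with
  | zero => exact h0
  | succ k ih =>
    rw [Function.iterate_succ_apply']; exact dualOp_nonneg hT (integrable_dualOp_iterate hg k) ih

/-- Decomposition of `{φ_A ≤ n + 1}` according to the last visit to `A` among the times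
`1, …, n + 1`. -/
theorem setIntegral_entranceSet_succ (hT : MeasurePreserving T μ μ) (hA : MeasurableSet A)
    (hg : Integrable g μ) (n : ℕ) :
    ∫ x in entranceSet T A (n + 1), g x ∂μ = ∑ j ∈ Finset.range (n + 1),
      ∫ x in A \ entranceSet T A j, (dualOp T μ)^[n - j + 1] g x ∂μ := by
  have hstep : ∀ (n : ℕ) {g : E → ℝ}, Integrable g μ → ∫ x in entranceSet T A (n + 1), g x ∂μ =
      ∫ x in entranceSet T A n, dualOp T μ g x ∂μ +
      ∫ x in A \ entranceSet T A n, dualOp T μ g x ∂μ := by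
    intro n g hg
    have hm := measurableSet_entranceSet hT.measurable hA n
    rw [entranceSet_succ, ← setIntegral_dualOp hT hg (hA.union hm), union_comm, ← union_sdiff_self,
      setIntegral_union disjoint_sdiff_right (hA.diff hm) (integrable_dualOp g).integrableOn
        (integrable_dualOp g).integrableOn]
  induction n generalizing g with
  | zero => simp [hstep 0 hg, entranceSet_zero]
  | succ n ih =>
    rw [hstep _ hg, ih (integrable_dualOp g), Finset.sum_range_succ _ (n + 1)]
    congr 1
    · refine Finset.sum_congr rfl fun j hj => ?_
      have : n + 1 - j + 1 = (n - j + 1) + 1 := by have := Finset.mem_range.1 hj; omega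
      rw [this, Function.iterate_succ_apply (dualOp T μ) (n - j + 1)]
    · simp


theorem dualSum_mono (hT : MeasurePreserving T μ μ) (hg : Integrable g μ) (h0 : 0 ≤ᵐ[μ] g) :
    ∀ᵐ x ∂μ, Monotone fun n => dualSum T μ g n x := by
  filter_upwards [ae_all_iff.2 fun k => dualOp_iterate_nonneg hT hg h0 (k + 1)] with x hx
  exact monotone_nat_of_le_succ fun n => by
    rw [dualSum, dualSum, Finset.sum_range_succ]
    exact le_add_of_nonneg_right (hx n)

/-- The last-visit decompositions summed over `n`; this brings in the sums of `T̂ᵏ g`, on `A`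
only. -/
theorem sum_setIntegral_entranceSet (hT : MeasurePreserving T μ μ) (hA : MeasurableSet A)
    (hg : Integrable g μ) (N : ℕ) :
    ∑ n ∈ Finset.range N, ∫ x in entranceSet T A (n + 1), g x ∂μ =
      ∑ j ∈ Finset.range N, ∫ x in A \ entranceSet T A j, dualSum T μ g (N - j) x ∂μ := by
  simp_rw [setIntegral_entranceSet_succ hT hA hg]
  rw [Finset.sum_range_diag_flip N fun j k =>
    ∫ x in A \ entranceSet T A j, (dualOp T μ)^[k + 1] g x ∂μ]
  refine Finset.sum_congr rfl fun j _ => ?_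
  simp only [dualSum]
  rw [integral_finsetSum]
  exact fun k _ => (integrable_dualOp_iterate hg (k + 1)).integrableOn

/-- The renewal asymptotics `∑_{j < n} μ(A ∩ {φ_A > j}) a (n - j) ∼ n`. In
`sum_setIntegral_entranceSet`, the sums of `T̂ᵏ g` are uniformly comparable on `A` to `a`, up to
finitely many indices, and the left-hand side is asymptotic to `n ∫ g` as almost every orbit
visits `A`. -/
theorem tendsto_renewalSum (hT : MeasurePreserving T μ μ) (hA : MeasurableSet A)
    (hA' : μ A < ∞) (hsweep : ∀ᵐ x ∂μ, x ∈ ⋃ n, entranceSet T A (n + 1))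
    (hg : Integrable g μ) (h0 : ∀ x, 0 ≤ g x) (hg0 : 0 < ∫ x, g x ∂μ) {a : ℕ → ℝ}
    (ha : Monotone a) (ha0 : a 0 = 0) (hapos : ∀ᶠ n in atTop, 0 < a n) {Z : Set E} (hZ : μ Z = 0)
    (hunif : TendstoUniformlyOn (dualAverage T μ a g) (fun _ => ∫ y, g y ∂μ) atTop (A \ Z)) :
    Tendsto (fun n : ℕ => renewalSum a (fun j => μ.real (A \ entranceSet T A j)) n / n) atTop
      (𝓝 1) := by
  set G := ∫ x, g x ∂μ with hG
  set q : ℕ → ℝ := fun j => μ.real (A \ entranceSet T A j) with hq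
  set X : ℕ → ℝ := fun N => ∑ n ∈ Finset.range N, ∫ x in entranceSet T A (n + 1), g x ∂μ with hX
  have hnn : ∀ m, 0 ≤ a m := fun m => ha0 ▸ ha (Nat.zero_le m)
  have hq0 : ∀ j, 0 ≤ q j := fun j => measureReal_nonneg
  have hqA : ∀ j, q j ≤ μ.real A := fun j => measureReal_mono sdiff_subset hA'.ne
  have hXlim : Tendsto (fun N : ℕ => X N / N) atTop (𝓝 G) := by
    have h1 : Tendsto (fun n : ℕ => ∫ x in entranceSet T A (n + 1), g x ∂μ) atTop (𝓝 G) := by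
      have := tendsto_setIntegral_of_monotone (μ := μ) (f := g)
        (s := fun n => entranceSet T A (n + 1))
        (fun n => measurableSet_entranceSet hT.measurable hA (n + 1))
        (fun _ _ h => entranceSet_mono (Nat.succ_le_succ h)) hg.integrableOn
      rwa [Measure.restrict_eq_self_of_ae_mem hsweep] at this
    refine h1.cesaro.congr fun N => ?_
    rw [inv_mul_eq_div]
  -- the two-sided comparison of the renewal sums with `X`
  have hcmp : ∀ ε : ℝ, 0 < ε → ε < G → ∃ C : ℝ, ∀ N : ℕ,
      (G - ε) * renewalSum a q N ≤ X N + C ∧ X N ≤ (G + ε) * renewalSum a q N + C := by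
    intro ε hε hεG
    rw [Metric.tendstoUniformlyOn_iff] at hunif
    obtain ⟨m0, hm0⟩ := eventually_atTop.1 ((hunif ε hε).and hapos)
    set c := (G + ε) * a m0 with hc
    have hc0 : 0 ≤ c := mul_nonneg (by linarith) (hnn _)
    have hpt : ∀ᵐ x ∂μ, x ∈ A → ∀ m,
        (G - ε) * a m - (if m < m0 then c else 0) ≤ dualSum T μ g m x ∧
        dualSum T μ g m x ≤ (G + ε) * a m + (if m < m0 then c else 0) := by
      have hZ' : ∀ᵐ x ∂μ, x ∉ Z := by simpa [ae_iff] using hZ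
      filter_upwards [hZ', dualSum_mono hT hg (Eventually.of_forall h0)] with x hxZ hmono hxA m
      have hbig : ∀ m, m0 ≤ m → (G - ε) * a m ≤ dualSum T μ g m x ∧
          dualSum T μ g m x ≤ (G + ε) * a m := by
        intro m hm
        obtain ⟨h1, h2⟩ := hm0 m hm
        have h3 := h1 x ⟨hxA, hxZ⟩
        rw [dualAverage_eq, Real.dist_eq, abs_lt] at h3
        constructor
        · rw [← le_div_iff₀ h2]; linarith
        · rw [← div_le_iff₀ h2]; linarith
      split_ifs with hm
      · have h1 : dualSum T μ g m x ≤ dualSum T μ g m0 x := hmono hm.le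
        have h2 := (hbig m0 le_rfl).2
        have h3 : 0 ≤ dualSum T μ g m x := by
          have : dualSum T μ g 0 x ≤ dualSum T μ g m x := hmono (Nat.zero_le m)
          simpa [dualSum] using this
        have h4 : (G - ε) * a m ≤ c := by
          have := ha hm.le
          have h5 := hnn m
          rw [hc]
          gcongr
          linarith
        have h5 : 0 ≤ (G + ε) * a m := mul_nonneg (by linarith) (hnn _)
        constructor <;> linarith
      · simpa using hbig m (not_lt.1 hm)
    refine ⟨m0 * (c * μ.real A), fun N => ?_⟩
    -- the error committed for small indices
    have herr : ∑ j ∈ Finset.range N, q j * (if N - j < m0 then c else 0) ≤ m0 * (c * μ.real A) := by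
      calc ∑ j ∈ Finset.range N, q j * (if N - j < m0 then c else 0)
          ≤ ∑ j ∈ Finset.range N, (if N - 1 - j < m0 then c * μ.real A else 0) := by
            refine Finset.sum_le_sum fun j _ => ?_
            by_cases h : N - j < m0
            · rw [if_pos h, if_pos (by omega), mul_comm]
              exact mul_le_mul_of_nonneg_left (hqA j) hc0
            · rw [if_neg h, mul_zero]
              split_ifs
              · exact mul_nonneg hc0 measureReal_nonneg
              · exact le_rfl
        _ = ∑ j ∈ Finset.range N, (if j < m0 then c * μ.real A else 0) :=
            Finset.sum_range_reflect (fun j => if j < m0 then c * μ.real A else 0) N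
        _ = ((Finset.range N).filter (· < m0)).card * (c * μ.real A) := by
            rw [← Finset.sum_filter, Finset.sum_const, nsmul_eq_mul]
        _ ≤ m0 * (c * μ.real A) := by
            refine mul_le_mul_of_nonneg_right ?_ (mul_nonneg hc0 measureReal_nonneg)
            have : ((Finset.range N).filter (· < m0)).card ≤ (Finset.range m0).card :=
              Finset.card_le_card fun j hj => by simpa using (Finset.mem_filter.1 hj).2
            rw [Finset.card_range] at this
            exact_mod_cast this
    have hint : ∀ j m, IntegrableOn (dualSum T μ g m) (A \ entranceSet T A j) μ := fun j m => by
      unfold dualSum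
      exact (integrable_finsetSum _ fun k _ => integrable_dualOp_iterate hg (k + 1)).integrableOn
    have hAj : ∀ j, MeasurableSet (A \ entranceSet T A j) := fun j =>
      hA.diff (measurableSet_entranceSet hT.measurable hA j)
    have hfin : ∀ j, μ (A \ entranceSet T A j) ≠ ∞ := fun j =>
      ((measure_mono sdiff_subset).trans_lt hA').ne
    have hterm : ∀ j m,
        q j * ((G - ε) * a m - (if m < m0 then c else 0)) ≤
          ∫ x in A \ entranceSet T A j, dualSum T μ g m x ∂μ ∧
        ∫ x in A \ entranceSet T A j, dualSum T μ g m x ∂μ ≤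
          q j * ((G + ε) * a m + (if m < m0 then c else 0)) := by
      intro j m
      have hconst : ∀ b : ℝ, ∫ _ in A \ entranceSet T A j, b ∂μ = q j * b := fun b => by
        rw [setIntegral_const, smul_eq_mul]
      rw [← hconst, ← hconst]
      constructor
      · refine setIntegral_mono_on_ae (integrableOn_const (hfin j)) (hint j m) (hAj j) ?_
        filter_upwards [hpt] with x hx hxA using (hx hxA.1 m).1
      · refine setIntegral_mono_on_ae (hint j m) (integrableOn_const (hfin j)) (hAj j) ?_
        filter_upwards [hpt] with x hx hxA using (hx hxA.1 m).2
    rw [hX]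
    simp only
    rw [sum_setIntegral_entranceSet hT hA hg N]
    have hlow := Finset.sum_le_sum fun j (_ : j ∈ Finset.range N) => (hterm j (N - j)).1
    have hupp := Finset.sum_le_sum fun j (_ : j ∈ Finset.range N) => (hterm j (N - j)).2
    simp only [mul_sub, mul_add, Finset.sum_sub_distrib, Finset.sum_add_distrib,
      mul_left_comm (q _) _ (a _), ← Finset.mul_sum] at hlow hupp
    have e : ∀ b : ℝ, ∑ j ∈ Finset.range N, b * (q j * a (N - j)) = b * renewalSum a q N :=
      fun b => by rw [renewalSum, Finset.mul_sum]
    constructor <;> rw [renewalSum] <;> linarith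
  have hlim : ∀ C : ℝ, Tendsto (fun N : ℕ => X N / N + C / N) atTop (𝓝 G) := fun C => by
    simpa using hXlim.add (tendsto_const_div_atTop_nhds_zero_nat C)
  refine tendsto_order.2 ⟨fun y hy => ?_, fun y hy => ?_⟩
  · obtain ⟨ε, hε, hεG, hεy⟩ : ∃ ε : ℝ, 0 < ε ∧ ε < G ∧ (G + ε) * y < G := by
      refine ⟨min (G * (1 - y) / 2) (G / 2), by
        have : 0 < 1 - y := by linarith
        positivity, (min_le_right _ _).trans_lt (by linarith), ?_⟩
      rcases le_or_gt y 0 with hy0 | hy0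
      · have : 0 < min (G * (1 - y) / 2) (G / 2) := by
          have : 0 < 1 - y := by linarith
          positivity
        nlinarith
      · have h1 : min (G * (1 - y) / 2) (G / 2) * y ≤ G * (1 - y) / 2 * y := by
          gcongr; exact min_le_left _ _
        nlinarith [mul_pos hg0 (by linarith : 0 < 1 - y)]
    obtain ⟨C, hC⟩ := hcmp ε hε hεG
    filter_upwards [(hlim (-C)).eventually_const_lt hεy, eventually_gt_atTop 0] with N hN hN0
    have hN' : (0 : ℝ) < N := by exact_mod_cast hN0
    have h1 := (hC N).2
    rw [← add_div, lt_div_iff₀ hN'] at hN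
    rw [lt_div_iff₀ hN']
    have hGε : 0 < G + ε := by linarith
    refine lt_of_mul_lt_mul_left ?_ hGε.le
    linarith
  · obtain ⟨ε, hε, hεG, hεy⟩ : ∃ ε : ℝ, 0 < ε ∧ ε < G ∧ G < (G - ε) * y := by
      have hy0 : 0 < y := by linarith
      refine ⟨G * (1 - 1 / y) / 2, ?_, ?_, ?_⟩
      · have : 1 / y < 1 := by rw [div_lt_one hy0]; exact hy
        have : 0 < 1 - 1 / y := by linarith
        positivity
      · have : 0 < 1 / y := by positivity
        nlinarith
      · have : (G - G * (1 - 1 / y) / 2) * y = G * (y + 1) / 2 := by field_simp; ring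
        rw [this]; nlinarith
    obtain ⟨C, hC⟩ := hcmp ε hε hεG
    filter_upwards [(hlim C).eventually_lt_const hεy, eventually_gt_atTop 0] with N hN hN0
    have hN' : (0 : ℝ) < N := by exact_mod_cast hN0
    have h1 := (hC N).1
    rw [← add_div, div_lt_iff₀ hN'] at hN
    rw [div_lt_iff₀ hN']
    have hGε : 0 < G - ε := by linarith
    refine lt_of_mul_lt_mul_left ?_ hGε.le
    linarith

/-- The sequence `a` with `a 0` and the negative terms replaced by `0`. This makes it monotone and
nonnegative, and changes finitely many terms if `a` is eventually positive. -/
noncomputable def truncSeq (a : ℕ → ℝ) (n : ℕ) : ℝ := if n = 0 then 0 else max (a n) 0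

theorem monotone_truncSeq {a : ℕ → ℝ} (ha : MonotoneOn a (Ici 1)) : Monotone (truncSeq a) := by
  intro m n h
  unfold truncSeq
  split_ifs with h1 h2 h2
  · exact le_rfl
  · exact le_max_right _ _
  · omega
  · exact max_le_max_right _ (ha (Nat.one_le_iff_ne_zero.2 h1) (Nat.one_le_iff_ne_zero.2 h2) h)

theorem truncSeq_eventuallyEq {a : ℕ → ℝ} (ha : ∀ᶠ n in atTop, 0 < a n) :
    truncSeq a =ᶠ[atTop] a := by
  filter_upwards [ha, eventually_gt_atTop 0] with n h1 h2
  simp [truncSeq, h2.ne', h1.le]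

theorem isRegularlyVarying_congr {a b : ℕ → ℝ} {ρ : ℝ} (h : b =ᶠ[atTop] a)
    (ha : IsRegularlyVarying a ρ) : IsRegularlyVarying b ρ := by
  refine ⟨by filter_upwards [h, ha.1] with n h1 h2; rwa [h1], fun c hc => ?_⟩
  have hf : Tendsto (fun N : ℕ => ⌊c * (N : ℝ)⌋₊) atTop atTop :=
    tendsto_nat_floor_atTop.comp (tendsto_natCast_atTop_atTop.const_mul_atTop hc)
  refine (ha.2 c hc).congr' ?_
  filter_upwards [h, hf.eventually h] with n h1 h2
  rw [h1, h2]

/-- The wandering rate of a subset `B` of positive measure of a uniform set satisfies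
`μ(φ_B ≤ n) ∼ C n / a n`, with `C` depending on `β` only. In particular, it is asymptotically the
same for all such `B`. -/
theorem tendsto_measure_entranceSet {a : ℕ → ℝ} (hT : IsPointwiseDualErgodic T μ a) {β : ℝ}
    (hβ : 0 < β) (hβ1 : β ≤ 1) (ha : IsRegularlyVarying a (1 - β)) (hA : IsUniformSet T μ A)
    {B : Set E} (hBA : B ⊆ A) (hB : MeasurableSet B) (hB' : 0 < μ B) :
    Tendsto (fun n : ℕ => μ.real (entranceSet T B n) * (a n / n)) atTop
      (𝓝 ((1 + β) * tauberConst β)) := by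
  obtain ⟨a', g, ha', -, hg0, hg, hgne, Z, hZ, hunif⟩ := hA.exists_uniform
  have hG : 0 < ∫ x, g x ∂μ :=
    (integral_pos_iff_support_of_nonneg hg0 hg).2 hgne
  have hmp := hT.ergodic.toMeasurePreserving
  have heq := truncSeq_eventuallyEq ha.1
  have hpos : ∀ᶠ n in atTop, 0 < truncSeq a n := by
    filter_upwards [heq, ha.1] with n h1 h2; rwa [h1]
  have hBt : μ B < ∞ := (measure_mono hBA).trans_lt hA.measure_lt_top
  have hpt : ∀ᵐ x ∂μ, Tendsto (fun n => dualAverage T μ (truncSeq a) g n x) atTop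
      (𝓝 (∫ y, g y ∂μ)) := by
    filter_upwards [hT.tendsto_ae g hg] with x hx
    refine hx.congr' ?_
    filter_upwards [heq] with n hn
    simp only [dualAverage_eq, hn]
  have hu := tendstoUniformlyOn_dualAverage_of_tendsto hA.measure_pos hZ hG hpos
    (ha'.2.eventually_gt_atTop 0) hpt hunif
  have hκ := tendsto_renewalSum hmp hB hBt
    (ae_exists_iterate_mem hT.conservative hT.ergodic hB hB') hg hg0 hG
    (monotone_truncSeq hT.increases.1) (by simp [truncSeq]) hpos hZ
    (hu.mono (sdiff_subset_sdiff_left hBA))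
  have := tendsto_sum_mul_div hβ hβ1 (monotone_truncSeq hT.increases.1) (by simp [truncSeq])
    (isRegularlyVarying_congr heq ha) (fun j => measureReal_nonneg) hκ
  refine this.congr' ?_
  filter_upwards [heq] with n hn
  rw [measureReal_entranceSet hmp hB hBt, hn]

theorem tendsto_measure_ratio {a : ℕ → ℝ} (hT : IsPointwiseDualErgodic T μ a) {β : ℝ}
    (hβ : 0 < β) (hβ1 : β ≤ 1) (ha : IsRegularlyVarying a (1 - β)) (hA : IsUniformSet T μ A)
    {B : Set E} (hBA : B ⊆ A) (hB : MeasurableSet B) (hB' : 0 < μ B) {t : ℝ} (ht : 0 < t) :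
    Tendsto (fun n : ℕ => μ.real (entranceSet T B ⌊t * n⌋₊) / μ.real (entranceSet T A n)) atTop
      (𝓝 (t ^ β)) := by
  have hC : (1 + β) * tauberConst β ≠ 0 := by
    have := tauberConst_pos hβ hβ1
    positivity
  have h1 := tendsto_measure_entranceSet hT hβ hβ1 ha hA hBA hB hB'
  have h2 := tendsto_measure_entranceSet hT hβ hβ1 ha hA subset_rfl hA.measurableSet hA.measure_pos
  have hf : Tendsto (fun N : ℕ => ⌊t * (N : ℝ)⌋₊) atTop atTop :=
    tendsto_nat_floor_atTop.comp (tendsto_natCast_atTop_atTop.const_mul_atTop ht)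
  have h3 : Tendsto (fun N : ℕ => (⌊t * (N : ℝ)⌋₊ : ℝ) / N) atTop (𝓝 t) :=
    (tendsto_nat_floor_mul_div_atTop ht.le).comp tendsto_natCast_atTop_atTop
  have h4 := (((h1.comp hf).div h2 hC).mul h3).div (ha.2 t ht) (by positivity)
  rw [div_self hC, one_mul] at h4
  have e : t / t ^ (1 - β) = t ^ β := by
    rw [Real.rpow_sub ht, Real.rpow_one]; field_simp
  rw [e] at h4
  refine h4.congr' ?_
  filter_upwards [hf.eventually_gt_atTop 0, eventually_gt_atTop 0, ha.1, hf.eventually ha.1]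
    with n hn hn0 han hafn
  have h5 : (0 : ℝ) < ⌊t * (n : ℝ)⌋₊ := by exact_mod_cast hn
  have h6 : (0 : ℝ) < n := by exact_mod_cast hn0
  simp only [Function.comp_apply, Pi.div_apply]
  field_simp

end

/-! ### Weak convergence of the paths -/

theorem SkorohodD.exists_forall_mem_of_isOpen {U : Set SkorohodD} (hU : IsOpen U) {x : SkorohodD}
    (hx : x ∈ U) : ∃ δ : ℝ, 0 < δ ∧ ∀ y, m1Dist x y ≤ ENNReal.ofReal δ → y ∈ U := by
  obtain ⟨ε, hε, h⟩ := hU x hx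
  obtain ⟨r, hr0, hr⟩ := ENNReal.lt_iff_exists_nnreal_btwn.1 hε
  refine ⟨r, by exact_mod_cast hr0, fun y hy => h y (hy.trans_lt ?_)⟩
  rwa [ENNReal.ofReal_coe_nnreal]

open SkorohodD

theorem continuous_stepPath {c : ℝ} (hc : 0 ≤ c) :
    Continuous fun v : Ioc (0 : ℝ) 1 => stepPath c v := by
  rw [continuous_def]
  intro U hU
  rw [Metric.isOpen_iff]
  intro v hv
  obtain ⟨δ, hδ, h⟩ := exists_forall_mem_of_isOpen hU hv
  refine ⟨δ / 8, by positivity, fun w hw => h _ ?_⟩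
  have hwv : |(w : ℝ) - v| < δ / 8 := hw
  refine ((nearStep_stepPath hc w.2 hwv).m1Dist_le hc v.2 (by positivity)).trans ?_
  exact ENNReal.ofReal_le_ofReal (by linarith)

section Paths
variable {E : Type*} {T : E → E} {A : Set E} {f : E → ℝ} {x : E}

theorem abs_le_partialMax {k n : ℕ} (h1 : 1 ≤ k) (h2 : k ≤ n) :
    |f (T^[k] x)| ≤ partialMax T f n x := by
  rw [← Real.norm_eq_abs, ← coe_nnnorm, partialMax, NNReal.coe_le_coe]
  exact Finset.le_sup (f := fun k => ‖f (T^[k] x)‖₊) (Finset.mem_Icc.2 ⟨h1, h2⟩)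

theorem partialMax_le {n : ℕ} {c : ℝ} (hc : 0 ≤ c)
    (h : ∀ k, 1 ≤ k → k ≤ n → |f (T^[k] x)| ≤ c) : partialMax T f n x ≤ c := by
  lift c to ℝ≥0 using hc
  rw [partialMax, NNReal.coe_le_coe, Finset.sup_le_iff]
  intro k hk
  rw [Finset.mem_Icc] at hk
  rw [← NNReal.coe_le_coe, coe_nnnorm, Real.norm_eq_abs]
  exact h k hk.1 hk.2

theorem partialMax_nonneg (n : ℕ) : 0 ≤ partialMax T f n x := NNReal.coe_nonneg _

theorem partialMax_mono : Monotone fun n => partialMax T f n x := fun _ _ h =>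
  partialMax_le (partialMax_nonneg _) fun _ h1 h2 => abs_le_partialMax h1 (h2.trans h)

theorem partialMax_eq_zero (hfA : Function.support f ⊆ A) {n : ℕ} (hx : x ∉ entranceSet T A n) :
    partialMax T f n x = 0 := by
  refine le_antisymm (partialMax_le le_rfl fun k h1 h2 => ?_) (partialMax_nonneg _)
  have : f (T^[k] x) = 0 := by
    by_contra h
    exact hx ⟨k, h1, h2, hfA h⟩
  simp [this]

theorem maxPath_mono (n : ℕ) : Monotone (maxPath T f n x).toFun := fun t t' h => by
  have h' : (t : ℝ) ≤ t' := h
  exact partialMax_mono (x := x) (Nat.floor_mono (by gcongr))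

theorem maxPath_zero (n : ℕ) : (maxPath T f n x).toFun 0 = 0 := by
  simp [maxPath, partialMax]

/-- If the first visit to `A` falls in `(s n, t n]`, and a point where `|f|` is almost maximal is
visited by time `t n`, then the path of the partial maxima is close to a step in `(s, t]`. -/
theorem nearStep_maxPath {c s t δ v : ℝ} (hc : 0 ≤ c) {n : ℕ} (hfA : Function.support f ⊆ A)
    (hfc : ∀ k, |f (T^[k] x)| ≤ c) (hv : v ∈ Ioc s t) (ht : t ≤ 1) (hst : t - s ≤ δ)
    (hs : x ∉ entranceSet T A ⌊s * n⌋₊)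
    (hx : x ∈ entranceSet T {y ∈ A | c - δ < |f y|} ⌊t * n⌋₊) :
    NearStep c v δ (maxPath T f n x) := by
  obtain ⟨k, hk1, hk2, -, hk3⟩ := hx
  have hlarge : ∀ u : I, t ≤ u → c - δ ≤ (maxPath T f n x).toFun u := fun u hu =>
    hk3.le.trans (abs_le_partialMax hk1 (hk2.trans (Nat.floor_mono (by rw [mul_comm]; gcongr))))
  refine ⟨maxPath_mono n, maxPath_zero n, fun u => partialMax_le hc fun k _ _ => hfc k,
    fun u hu => ?_, fun u hu => hlarge u ?_, hlarge 1 ht⟩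
  · refine partialMax_eq_zero hfA fun hmem => hs (entranceSet_mono (Nat.floor_mono ?_) hmem)
    rw [mul_comm]
    have : (u : ℝ) ≤ s := by linarith [hv.2]
    gcongr
  · linarith [hv.1, hv.2]

end Paths

section Measurability
variable {E : Type*} [MeasurableSpace E] {T : E → E} {f : E → ℝ}

theorem measurable_partialMax (hT : Measurable T) (hf : Measurable f) (n : ℕ) :
    Measurable (partialMax T f n) := by
  have : Measurable fun x => (Finset.Icc 1 n).sup fun k => ‖f (T^[k] x)‖₊ := by
    have h := Finset.sup_induction (p := fun g : E → ℝ≥0 => Measurable g) (s := Finset.Icc 1 n)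
      (f := fun k x => ‖f (T^[k] x)‖₊) measurable_const (fun _ h1 _ h2 => h1.sup h2)
      fun k _ => (hf.comp (hT.iterate k)).nnnorm
    convert h using 1
    ext x
    rw [Finset.sup_apply]
  exact this.coe_nnreal_real

/-- The path depends on finitely many partial maxima, and continuously so for the `M₁` topology:
the preimage of an open set is the preimage of an open set of `ℝⁿ⁺¹`. -/
theorem measurable_maxPath (hT : Measurable T) (hf : Measurable f) (n : ℕ) :
    Measurable (maxPath T f n) := by
  refine measurable_of_isOpen fun U hU => ?_
  set Φ : E → Fin (n + 1) → ℝ := fun x k => partialMax T f k x with hΦ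
  have hΦm : Measurable Φ := measurable_pi_lambda _ fun k => measurable_partialMax hT hf k
  set W : Set (Fin (n + 1) → ℝ) := ⋃ p : {p : E × ℝ // 0 < p.2 ∧
    ∀ y, m1Dist (maxPath T f n p.1) y ≤ ENNReal.ofReal p.2 → y ∈ U},
      Metric.ball (Φ p.1.1) (p.1.2 / 4) with hW
  have hWo : IsOpen W := isOpen_iUnion fun _ => Metric.isOpen_ball
  have : maxPath T f n ⁻¹' U = Φ ⁻¹' W := by
    ext x
    constructor
    · intro hx
      obtain ⟨δ, hδ, h⟩ := exists_forall_mem_of_isOpen hU hx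
      exact mem_iUnion.2 ⟨⟨(x, δ), hδ, h⟩, Metric.mem_ball_self (by positivity)⟩
    · intro hx
      obtain ⟨⟨⟨x', δ⟩, hδ, h⟩, hd⟩ := mem_iUnion.1 hx
      have hd : dist (Φ x) (Φ x') < δ / 4 := hd
      refine h _ ((m1Dist_le_of_uniform (maxPath_mono n) (maxPath_mono n) (maxPath_zero n)
        (maxPath_zero n) (δ := δ / 4) fun t => ?_).trans
          (ENNReal.ofReal_le_ofReal (by linarith)))
      have hle : ⌊(n : ℝ) * t⌋₊ < n + 1 := by
        refine Nat.lt_succ_of_le (Nat.floor_le_of_le ?_)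
        exact mul_le_of_le_one_right n.cast_nonneg t.2.2
      have := (dist_le_pi_dist (Φ x) (Φ x') ⟨_, hle⟩).trans hd.le
      rw [dist_comm, Real.dist_eq] at this
      exact this
  rw [this]
  exact hΦm hWo.measurableSet

end Measurability

section SupNorm
variable {E : Type*} [MeasurableSpace E] {μ : Measure E} {A : Set E} {f : E → ℝ}

theorem zero_mem_lowerBounds_aeBounds (hA : μ A ≠ 0) :
    0 ∈ lowerBounds {M : ℝ | ∀ᵐ x ∂(μ.restrict A), |f x| ≤ M} := by
  intro M hM
  have : NeBot (ae (μ.restrict A)) := by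
    rw [ae_neBot]; simpa [Measure.restrict_eq_zero] using hA
  have hM' : ∀ᵐ x ∂(μ.restrict A), |f x| ≤ M := hM
  obtain ⟨x, hx⟩ := hM'.exists
  exact (abs_nonneg _).trans hx

theorem supNormOn_nonneg (hA : μ A ≠ 0) : 0 ≤ supNormOn μ A f :=
  Real.sInf_nonneg fun _ hM => zero_mem_lowerBounds_aeBounds hA hM

theorem ae_abs_le_supNormOn (hfb : ∃ C : ℝ, ∀ x, |f x| ≤ C) :
    ∀ᵐ x ∂(μ.restrict A), |f x| ≤ supNormOn μ A f := by
  obtain ⟨C, hC⟩ := hfb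
  have h : ∀ n : ℕ, ∀ᵐ x ∂(μ.restrict A), |f x| ≤ supNormOn μ A f + 1 / ((n : ℝ) + 1) := by
    intro n
    obtain ⟨M, hM, hlt⟩ := Real.lt_sInf_add_pos (s := {M : ℝ | ∀ᵐ x ∂(μ.restrict A), |f x| ≤ M})
      ⟨C, mem_ofPred.2 (Eventually.of_forall hC)⟩ (show (0 : ℝ) < 1 / ((n : ℝ) + 1) by positivity)
    have hM' : ∀ᵐ x ∂(μ.restrict A), |f x| ≤ M := hM
    filter_upwards [hM'] with x hx using hx.trans hlt.le
  filter_upwards [ae_all_iff.2 h] with x hx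
  have := tendsto_one_div_add_atTop_nhds_zero_nat (𝕜 := ℝ)
  exact ge_of_tendsto' (by simpa using this.const_add (supNormOn μ A f)) hx

theorem measure_supNormOn_sub_lt_pos (hA : MeasurableSet A) (hA' : μ A ≠ 0) {δ : ℝ} (hδ : 0 < δ) :
    0 < μ {x ∈ A | supNormOn μ A f - δ < |f x|} := by
  rw [pos_iff_ne_zero]
  intro h0
  have : supNormOn μ A f - δ ∈ {M : ℝ | ∀ᵐ x ∂(μ.restrict A), |f x| ≤ M} := by
    rw [mem_ofPred_eq, ae_restrict_iff' hA, ae_iff]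
    convert h0 using 2
    ext x; simp
  have := csInf_le ⟨0, zero_mem_lowerBounds_aeBounds hA'⟩ this
  change supNormOn μ A f ≤ _ at this
  linarith

theorem ae_abs_iterate_le_supNormOn {T : E → E} (hT : MeasurePreserving T μ μ)
    (hA : MeasurableSet A) (hA' : μ A ≠ 0) (hfb : ∃ C : ℝ, ∀ x, |f x| ≤ C)
    (hfA : Function.support f ⊆ A) : ∀ᵐ x ∂μ, ∀ k, |f (T^[k] x)| ≤ supNormOn μ A f := by
  have h : ∀ᵐ x ∂μ, |f x| ≤ supNormOn μ A f := by
    filter_upwards [(ae_restrict_iff' hA).1 (ae_abs_le_supNormOn hfb)] with x hx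
    by_cases hxA : x ∈ A
    · exact hx hxA
    · rw [Function.notMem_support.1 fun h => hxA (hfA h), abs_zero]
      exact supNormOn_nonneg hA'
  exact ae_all_iff.2 fun k => (hT.iterate k).quasiMeasurePreserving.ae h

end SupNorm

section Limit
variable {Ω : Type*} [MeasurableSpace Ω] {P : Measure Ω} {V : Ω → ℝ} {β : ℝ}

/-- The formula for the distribution function holds at `0` too. -/
theorem measure_setOf_le_eq (hβ : 0 < β)
    (hVlaw : ∀ x : ℝ, 0 < x → x ≤ 1 → P {ω | V ω ≤ x} = ENNReal.ofReal (x ^ β)) {x : ℝ}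
    (hx : x ∈ Icc (0 : ℝ) 1) : P {ω | V ω ≤ x} = ENNReal.ofReal (x ^ β) := by
  rcases hx.1.eq_or_lt with rfl | hx0
  swap
  · exact hVlaw x hx0 hx.2
  rw [Real.zero_rpow hβ.ne', ENNReal.ofReal_zero, ← nonpos_iff_eq_zero]
  have hlim : Tendsto (fun x : ℝ => ENNReal.ofReal (x ^ β)) (𝓝[>] 0) (𝓝 0) := by
    have : Tendsto (fun x : ℝ => ENNReal.ofReal (x ^ β)) (𝓝 0) (𝓝 (ENNReal.ofReal (0 ^ β))) :=
      (ENNReal.continuous_ofReal.tendsto _).comp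
        (Real.continuousAt_rpow_const 0 β (Or.inr hβ.le)).tendsto
    rw [Real.zero_rpow hβ.ne', ENNReal.ofReal_zero] at this
    exact this.mono_left nhdsWithin_le_nhds
  refine ge_of_tendsto hlim ?_
  filter_upwards [Ioc_mem_nhdsGT (zero_lt_one (α := ℝ))] with x hx
  rw [← hVlaw x hx.1 hx.2]
  exact measure_mono fun ω hω => le_trans hω hx.1.le

variable [IsProbabilityMeasure P]

theorem ae_mem_Ioc (hβ : 0 < β) (hV : Measurable V)
    (hVlaw : ∀ x : ℝ, 0 < x → x ≤ 1 → P {ω | V ω ≤ x} = ENNReal.ofReal (x ^ β)) :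
    ∀ᵐ ω ∂P, V ω ∈ Ioc (0 : ℝ) 1 := by
  have h0 : ∀ᵐ ω ∂P, 0 < V ω := by
    have := measure_setOf_le_eq hβ hVlaw (x := 0) (by simp)
    rw [Real.zero_rpow hβ.ne', ENNReal.ofReal_zero] at this
    simpa [ae_iff] using this
  have h1 : ∀ᵐ ω ∂P, V ω ≤ 1 := by
    have h := hVlaw 1 zero_lt_one le_rfl
    rw [Real.one_rpow, ENNReal.ofReal_one] at h
    exact (prob_compl_eq_zero_iff (measurableSet_le hV measurable_const)).2 h
  filter_upwards [h0, h1] with ω h2 h3 using ⟨h2, h3⟩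

theorem aemeasurable_stepPath (hβ : 0 < β) (hV : Measurable V)
    (hVlaw : ∀ x : ℝ, 0 < x → x ≤ 1 → P {ω | V ω ≤ x} = ENNReal.ofReal (x ^ β)) {c : ℝ}
    (hc : 0 ≤ c) : AEMeasurable (fun ω => stepPath c (V ω)) P := by
  classical
  set V' : Ω → ℝ := fun ω => if V ω ∈ Ioc (0 : ℝ) 1 then V ω else 1 with hV'
  have hV'm : Measurable V' := Measurable.ite (hV measurableSet_Ioc) hV measurable_const
  have hmem : ∀ ω, V' ω ∈ Ioc (0 : ℝ) 1 := fun ω => by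
    simp only [hV']; split_ifs with h
    · exact h
    · simp
  refine ⟨fun ω => stepPath c (V' ω), (continuous_stepPath hc).measurable.comp
    (hV'm.subtype_mk (h := hmem)), ?_⟩
  filter_upwards [ae_mem_Ioc hβ hV hVlaw] with ω hω
  simp only [hV', if_pos hω]

/-- The event that the limit path lies in an open set `U` is exhausted by the events that all paths
close to it do. No measurability of the latter events is needed. -/
theorem measure_stepPath_le_iSup (hβ : 0 < β) (hV : Measurable V)
    (hVlaw : ∀ x : ℝ, 0 < x → x ≤ 1 → P {ω | V ω ≤ x} = ENNReal.ofReal (x ^ β)) {c : ℝ}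
    (hc : 0 ≤ c) {U : Set SkorohodD} (hU : IsOpen U) :
    P {ω | stepPath c (V ω) ∈ U} ≤ ⨆ m : ℕ, P {ω | V ω ∈ Ioc (0 : ℝ) 1 ∧
      ∀ x, NearStep c (V ω) (1 / ((m : ℝ) + 1)) x → x ∈ U} := by
  rw [← Monotone.measure_iUnion]
  · refine measure_mono_ae ?_
    filter_upwards [ae_mem_Ioc hβ hV hVlaw] with ω hω hωU
    obtain ⟨δ, hδ, h⟩ := exists_forall_mem_of_isOpen hU hωU
    obtain ⟨m, hm⟩ := exists_nat_one_div_lt (show (0 : ℝ) < δ / 8 by positivity)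
    refine mem_iUnion.2 ⟨m, hω, fun x hx => h x ?_⟩
    refine (hx.m1Dist_le hc hω (by positivity)).trans (ENNReal.ofReal_le_ofReal ?_)
    linarith
  · intro m m' h ω hω
    have hle : (1 : ℝ) / ((m' : ℝ) + 1) ≤ 1 / ((m : ℝ) + 1) := by gcongr
    refine ⟨hω.1, fun x hx => hω.2 x ⟨hx.mono, hx.zero, hx.le, fun t ht => hx.before t (by linarith),
      fun t ht => ?_, ?_⟩⟩
    · have := hx.after t (by linarith); linarith
    · have := hx.one; linarith

/-- The law of `V` on a set is bounded by its mass on the cells `(i / (m + 1), (i + 1) / (m + 1)]`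
that meet the set. -/
theorem measure_mem_le_sum (hβ : 0 < β) (hV : Measurable V)
    (hVlaw : ∀ x : ℝ, 0 < x → x ≤ 1 → P {ω | V ω ≤ x} = ENNReal.ofReal (x ^ β)) (S : Set ℝ)
    (hS : S ⊆ Ioc 0 1) {m : ℕ} (J : Finset ℕ) (hI : ∀ i ∈ J, i < m + 1)
    (hmem : ∀ i < m + 1, (S ∩ Ioc ((i : ℝ) / (m + 1)) (((i : ℝ) + 1) / (m + 1))).Nonempty → i ∈ J) :
    P {ω | V ω ∈ S} ≤ ENNReal.ofReal
      (∑ i ∈ J, ((((i : ℝ) + 1) / (m + 1)) ^ β - ((i : ℝ) / (m + 1)) ^ β)) := by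
  have hm : (0 : ℝ) < m + 1 := by positivity
  have hmono : ∀ i : ℕ, ((i : ℝ) / (m + 1)) ^ β ≤ (((i : ℝ) + 1) / (m + 1)) ^ β := fun i =>
    Real.rpow_le_rpow (by positivity) (by gcongr; linarith) hβ.le
  rw [ENNReal.ofReal_sum_of_nonneg fun i _ => sub_nonneg.2 (hmono i)]
  have hcover : {ω | V ω ∈ S} ⊆
      ⋃ i ∈ J, {ω | V ω ≤ ((i : ℝ) + 1) / (m + 1)} \ {ω | V ω ≤ (i : ℝ) / (m + 1)} := by
    intro ω hω
    have hω01 := hS hω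
    have h0 : 0 < V ω * (m + 1) := mul_pos hω01.1 hm
    obtain ⟨i, hi⟩ : ∃ i, ⌈V ω * (m + 1)⌉₊ = i + 1 :=
      Nat.exists_eq_succ_of_ne_zero (Nat.ceil_pos.2 h0).ne'
    have h1 : V ω * (m + 1) ≤ (i : ℝ) + 1 := by
      have := Nat.le_ceil (V ω * (m + 1)); rw [hi] at this; exact_mod_cast this
    have h2 : (i : ℝ) < V ω * (m + 1) := Nat.lt_ceil.1 (by omega)
    have h3 : i < m + 1 := by
      have : (i : ℝ) < m + 1 := by nlinarith [hω01.2]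
      exact_mod_cast this
    have h4 : V ω ∈ Ioc ((i : ℝ) / (m + 1)) (((i : ℝ) + 1) / (m + 1)) :=
      ⟨by rwa [div_lt_iff₀ hm], by rwa [le_div_iff₀ hm]⟩
    exact mem_biUnion (hmem i h3 ⟨V ω, hω, h4⟩) ⟨h4.2, not_le.2 h4.1⟩
  refine (measure_mono hcover).trans ((measure_biUnion_finset_le _ _).trans
    (Finset.sum_le_sum fun i hi => ?_))
  have hi' : (i : ℝ) + 1 ≤ m + 1 := by exact_mod_cast hI i hi
  have hb : ((i : ℝ) + 1) / (m + 1) ∈ Icc (0 : ℝ) 1 :=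
    ⟨by positivity, by rwa [div_le_one hm]⟩
  have ha : (i : ℝ) / (m + 1) ∈ Icc (0 : ℝ) 1 :=
    ⟨by positivity, by rw [div_le_one hm]; linarith⟩
  have hsub : {ω | V ω ≤ (i : ℝ) / (m + 1)} ⊆ {ω | V ω ≤ ((i : ℝ) + 1) / (m + 1)} := fun ω hω =>
    le_trans (mem_ofPred.1 hω) (by gcongr; linarith)
  rw [measure_sdiff hsub (measurableSet_le hV measurable_const).nullMeasurableSet
    (measure_ne_top _ _), measure_setOf_le_eq hβ hVlaw hb, measure_setOf_le_eq hβ hVlaw ha,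
    ENNReal.ofReal_sub _ (Real.rpow_nonneg ha.1 _)]

end Limit

section Main
variable {E : Type*} [MeasurableSpace E] {μ : Measure E} {T : E → E} {A : Set E} {f : E → ℝ}

theorem entranceMeasure_eq (n : ℕ) :
    entranceMeasure T μ A n = ProbabilityTheory.cond μ (entranceSet T A n) := by
  rw [entranceMeasure]
  congr 1
  ext x
  exact firstEntrance_le_iff

theorem isProbabilityMeasure_entranceMeasure (hT : MeasurePreserving T μ μ) (hA : MeasurableSet A)
    (h0 : 0 < μ A) (h1 : μ A < ∞) (n : ℕ) : IsProbabilityMeasure (entranceMeasure T μ A (n + 1)) := by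
  rw [entranceMeasure_eq]
  exact ProbabilityTheory.cond_isProbabilityMeasure_of_finite
    (measure_entranceSet_pos hT hA h0 n).ne' (measure_entranceSet_lt_top hT hA h1 _).ne

/-- Lower bound for the probability that the path of the partial maxima lies in `U`. It does if, for
some cell `i ∈ J`, the first visit to `A` falls in the cell and a point where `|f|` is almost maximal
is visited before its end; these events are disjoint for different cells. -/
theorem ofReal_sum_le_entranceMeasure (hT : MeasurePreserving T μ μ) (hA : MeasurableSet A)
    (h0 : 0 < μ A) (h1 : μ A < ∞) (hf : Measurable f) (hfb : ∃ C : ℝ, ∀ x, |f x| ≤ C)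
    (hfA : Function.support f ⊆ A) {U : Set SkorohodD} {m : ℕ} {J : Finset ℕ}
    (hI : ∀ i ∈ J, i < m + 1)
    (hU : ∀ i ∈ J, ∃ v ∈ Ioc ((i : ℝ) / (m + 1)) (((i : ℝ) + 1) / (m + 1)),
      ∀ x, NearStep (supNormOn μ A f) v (1 / ((m : ℝ) + 1)) x → x ∈ U) {n : ℕ} (hn : n ≠ 0) :
    ENNReal.ofReal (∑ i ∈ J,
      (μ.real (entranceSet T {y ∈ A | supNormOn μ A f - 1 / ((m : ℝ) + 1) < |f y|}
          ⌊((i : ℝ) + 1) / (m + 1) * n⌋₊) / μ.real (entranceSet T A n) -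
        μ.real (entranceSet T A ⌊(i : ℝ) / (m + 1) * n⌋₊) / μ.real (entranceSet T A n))) ≤
      entranceMeasure T μ A n (maxPath T f n ⁻¹' U) := by
  set c := supNormOn μ A f with hc
  set B : Set E := {y ∈ A | c - 1 / ((m : ℝ) + 1) < |f y|} with hB
  have hBm : MeasurableSet B := hA.inter (measurableSet_lt measurable_const hf.abs)
  have hm : (0 : ℝ) < m + 1 := by positivity
  obtain ⟨n, rfl⟩ := Nat.exists_eq_succ_of_ne_zero hn
  have hprob := isProbabilityMeasure_entranceMeasure hT hA h0 h1 n
  set ν := entranceMeasure T μ A (n + 1) with hν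
  have hDm := measurableSet_entranceSet hT.measurable hA
  have hDt := measure_entranceSet_lt_top hT hA h1
  set K : ℕ → Set E := fun i => entranceSet T B ⌊((i : ℝ) + 1) / (m + 1) * (n + 1 : ℕ)⌋₊ \
    entranceSet T A ⌊(i : ℝ) / (m + 1) * (n + 1 : ℕ)⌋₊ with hK
  have hKm : ∀ i, MeasurableSet (K i) := fun i =>
    (measurableSet_entranceSet hT.measurable hBm _).diff (hDm _)
  have hdisj : ∀ i j, i < j → Disjoint (K i) (K j) := by
    intro i j hij
    rw [Set.disjoint_left]
    rintro x ⟨hx1, -⟩ ⟨-, hx2⟩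
    refine hx2 (entranceSet_mono (Nat.floor_mono ?_) (entranceSet_subset (fun y hy => hy.1) _ hx1))
    have : (i : ℝ) + 1 ≤ j := by exact_mod_cast hij
    gcongr
  have hdisj' : (J : Set ℕ).PairwiseDisjoint K := fun i _ j _ hij => by
    rcases lt_or_gt_of_ne hij with h | h
    · exact hdisj i j h
    · exact (hdisj j i h).symm
  have hsub : ν (⋃ i ∈ J, K i) ≤ ν (maxPath T f (n + 1) ⁻¹' U) := by
    have hac : ν ≪ μ := by rw [hν, entranceMeasure_eq]; exact ProbabilityTheory.cond_absolutelyContinuous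
    refine measure_mono_ae (hac.ae_le ?_)
    filter_upwards [ae_abs_iterate_le_supNormOn hT hA h0.ne' hfb hfA] with x hx hxK
    obtain ⟨i, hiI, hxi⟩ := mem_iUnion₂.1 hxK
    obtain ⟨v, hv, hvU⟩ := hU i hiI
    have hi : (i : ℝ) + 1 ≤ m + 1 := by exact_mod_cast hI i hiI
    refine hvU _ (nearStep_maxPath (supNormOn_nonneg h0.ne') hfA hx hv (by rwa [div_le_one hm])
      (le_of_eq (by ring)) hxi.2 hxi.1)
  refine le_trans ?_ hsub
  rw [measure_biUnion_finset hdisj' fun i _ => hKm i, ENNReal.ofReal_le_iff_le_toReal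
    (ENNReal.sum_lt_top.2 fun i _ => measure_lt_top _ _).ne,
    ENNReal.toReal_sum fun i _ => measure_ne_top _ _]
  refine Finset.sum_le_sum fun i hi => ?_
  have hi' : (i : ℝ) + 1 ≤ m + 1 := by exact_mod_cast hI i hi
  have hKD : entranceSet T A (n + 1) ∩ K i = K i := by
    refine inter_eq_right.2 fun x hx => ?_
    refine entranceSet_mono (Nat.floor_le_of_le ?_) (entranceSet_subset (fun y hy => hy.1) _ hx.1)
    have : ((i : ℝ) + 1) / (m + 1) ≤ 1 := by rwa [div_le_one hm]
    exact mul_le_of_le_one_left (Nat.cast_nonneg _) this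
  have hνK : (ν (K i)).toReal = μ.real (K i) / μ.real (entranceSet T A (n + 1)) := by
    rw [hν, entranceMeasure_eq, ProbabilityTheory.cond_apply (hDm _), hKD, ENNReal.toReal_mul,
      ENNReal.toReal_inv, inv_mul_eq_div]
    rfl
  rw [hνK, ← sub_div]
  refine div_le_div_of_nonneg_right ?_ measureReal_nonneg
  exact le_measureReal_sdiff (hDt _).ne

end Main

end MaxErgodic

open MaxErgodic SkorohodD in
/-- The laws are indexed by `n + 1`, that is, by `n = 1, 2, …`, as `μ_0` is not defined. -/
theorem proposition2p1 {E : Type*} [MeasurableSpace E] (μ : Measure E) [SigmaFinite μ]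
    (hμ : μ univ = ∞) (T : E → E) (a : ℕ → ℝ)
    (hT : MaxErgodic.IsPointwiseDualErgodic T μ a)
    (β : ℝ) (hβ : 0 < β) (hβ1 : β ≤ 1) (ha : MaxErgodic.IsRegularlyVarying a (1 - β))
    (A : Set E) (hA : MaxErgodic.IsUniformSet T μ A)
    (f : E → ℝ) (hf : Measurable f) (hfb : ∃ C : ℝ, ∀ x, |f x| ≤ C)
    (hfA : Function.support f ⊆ A)
    {Ω : Type*} [MeasurableSpace Ω] (P : Measure Ω) [IsProbabilityMeasure P]
    (V : Ω → ℝ) (hV : Measurable V)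
    (hVlaw : ∀ x : ℝ, 0 < x → x ≤ 1 → P {ω | V ω ≤ x} = ENNReal.ofReal (x ^ β)) :
    ∃ _ : ∀ n : ℕ, IsProbabilityMeasure (MaxErgodic.entranceMeasure T μ A (n + 1)),
      TendstoInDistribution (fun (n : ℕ) (x : E) => MaxErgodic.maxPath T f (n + 1) x) atTop
        (fun ω => MaxErgodic.stepPath (MaxErgodic.supNormOn μ A f) (V ω))
        (fun n : ℕ => MaxErgodic.entranceMeasure T μ A (n + 1)) P := by
  classical
  have hmp := hT.ergodic.toMeasurePreserving
  have hA0 := hA.measure_pos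
  have hprob := isProbabilityMeasure_entranceMeasure hmp hA.measurableSet hA0 hA.measure_lt_top
  have hc : 0 ≤ supNormOn μ A f := supNormOn_nonneg hA0.ne'
  have hXm : ∀ n, Measurable (maxPath T f n) := measurable_maxPath hmp.measurable hf
  have hZm := aemeasurable_stepPath hβ hV hVlaw hc
  refine ⟨hprob, fun n => (hXm (n + 1)).aemeasurable, hZm, ?_⟩
  refine tendsto_of_forall_isOpen_le_liminf' fun U hU => ?_
  change P.map _ U ≤ liminf (fun n : ℕ => (entranceMeasure T μ A (n + 1)).map (maxPath T f (n + 1)) U)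
    atTop
  rw [Measure.map_apply_of_aemeasurable hZm hU.measurableSet]
  simp_rw [fun n => Measure.map_apply (μ := entranceMeasure T μ A n) (hXm n) hU.measurableSet]
  refine (measure_stepPath_le_iSup hβ hV hVlaw hc hU).trans (iSup_le fun m => ?_)
  set S : Set ℝ := {v | v ∈ Ioc (0 : ℝ) 1 ∧
    ∀ x, NearStep (supNormOn μ A f) v (1 / ((m : ℝ) + 1)) x → x ∈ U} with hS
  set J : Finset ℕ := (Finset.range (m + 1)).filter fun i =>
    (S ∩ Ioc ((i : ℝ) / (m + 1)) (((i : ℝ) + 1) / (m + 1))).Nonempty with hI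
  have hIlt : ∀ i ∈ J, i < m + 1 := fun i hi => Finset.mem_range.1 (Finset.mem_filter.1 hi).1
  refine (measure_mem_le_sum hβ hV hVlaw S (fun v hv => hv.1) J hIlt
    fun i hi hne => Finset.mem_filter.2 ⟨Finset.mem_range.2 hi, hne⟩).trans ?_
  have hm : (0 : ℝ) < m + 1 := by positivity
  have hlim : ∀ i : ℕ, Tendsto (fun n : ℕ =>
      μ.real (entranceSet T {y ∈ A | supNormOn μ A f - 1 / ((m : ℝ) + 1) < |f y|}
          ⌊((i : ℝ) + 1) / (m + 1) * n⌋₊) / μ.real (entranceSet T A n) -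
        μ.real (entranceSet T A ⌊(i : ℝ) / (m + 1) * n⌋₊) / μ.real (entranceSet T A n)) atTop
      (𝓝 ((((i : ℝ) + 1) / (m + 1)) ^ β - ((i : ℝ) / (m + 1)) ^ β)) := by
    intro i
    refine Tendsto.sub (tendsto_measure_ratio hT hβ hβ1 ha hA (fun y hy => hy.1)
      (hA.measurableSet.inter (measurableSet_lt measurable_const hf.abs))
      (measure_supNormOn_sub_lt_pos hA.measurableSet hA0.ne' (by positivity)) (by positivity)) ?_
    rcases i.eq_zero_or_pos with rfl | hi
    · simp [entranceSet_zero, Real.zero_rpow hβ.ne']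
    · have : (0 : ℝ) < i := by exact_mod_cast hi
      exact tendsto_measure_ratio hT hβ hβ1 ha hA subset_rfl hA.measurableSet hA0 (by positivity)
  have hsum := ENNReal.tendsto_ofReal (tendsto_finsetSum J fun i _ => hlim i)
  rw [← (hsum.comp (tendsto_add_atTop_nat 1)).liminf_eq]
  refine liminf_le_liminf (Eventually.of_forall fun n => ?_)
  refine ofReal_sum_le_entranceMeasure hmp hA.measurableSet hA0 hA.measure_lt_top hf hfb hfA hIlt
    (fun i hi => ?_) n.succ_ne_zero
  obtain ⟨v, hv, hvJ⟩ := (Finset.mem_filter.1 hi).2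
  exact ⟨v, hvJ, hv.2⟩
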